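/- **Theorem (Reverse isoperimetric inequality on $\mathbb S^2$).** Let $\gamma:\mathbb S^1\to\mathbb S^2\subset\mathbb R^3$ be a smooth, regular, simple closed curve, positively oriented as the boundary of the enclosed domain $\Omega\subset\mathbb S^2$; that is, $\Omega$ is open and connected, $\partial\Omega=\gamma(\mathbb S^1)$, and $\Omega$ lies on the side of $\gamma$ to which $\eta:=\gamma\times\gamma_s$ points, and not on the other side, where $s$ denotes arclength. Let $k_g:=\langle\gamma_{ss},\eta\rangle$ be the geodesic curvature, and assume that $\gamma$ is strictly convex, i.e. $k_g>0$ everywhere. Let $L$ be the length of $\gamma$ and $A$ the spherical area of $\Omega$. Then $A\in(0,2\pi)$, and \[ L^{2}-A(4\pi-A)\le\Bigl(\int_{\gamma}\sqrt{1+k_g^{2}}\,ds\Bigr)^{2}-4\pi^{2}. \] In fact, \[ L^{2}-A(4\pi-A)=\Bigl(\int_{\gamma}\sqrt{1+k_g^{2}}\,ds\Bigr)^{2}-4\pi^{2}-\mathcal R(\gamma), \] where \[ \mathcal R(\gamma):=\iint_{\gamma\times\gamma}\frac{(k_g(s)-k_g(\sigma))^{2}}{\sqrt{(1+k_g(s)^{2})(1+k_g(\sigma)^{2})}+1+k_g(s)k_g(\sigma)}\,ds\,d\sigma\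 \ge 0, \] the denominator being positive everywhere. Equality holds in the inequality if and only if $\gamma$ is a geodesic circle, i.e. its image is the set of all points of $\mathbb S^2$ at spherical distance $r$ from some point $p\in\mathbb S^2$, for some $r\in(0,\pi)$. -/

import Mathlib

open scoped Manifold ContDiff

namespace SphereCurve

noncomputable section

/-- Euclidean three-space. -/
abbrev E3 : Type := EuclideanSpace ℝ (Fin 3)

/-- The unit sphere `S²` in Euclidean three-space. -/
abbrev S2 : Type := Metric.sphere (0 : E3) 1

/-- The cross product on Euclidean three-space. -/
def cross (x y : E3) : E3 := WithLp.toLp 2 (crossProduct (WithLp.ofLp x) (WithLp.ofLp y))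

/-- The `2π`-periodic parametrisation `t ↦ γ(e^{it})` of a closed curve `γ : S¹ → S²`,
with values in Euclidean space. -/
def lift (γ : Circle → S2) (t : ℝ) : E3 := (γ (Circle.exp t) : E3)

/-- The speed `ds/dt`. -/
def speed (γ : Circle → S2) (t : ℝ) : ℝ := ‖deriv (lift γ) t‖

/-- The unit tangent vector `γ_s`. -/
def tangent (γ : Circle → S2) (t : ℝ) : E3 := (speed γ t)⁻¹ • deriv (lift γ) t

/-- The unit conormal `η = γ × γ_s`, pointing to the left of the curve
(the sphere being oriented by its outward normal). -/
def conormal (γ : Circle → S2) (t : ℝ) : E3 := cross (lift γ t) (tangent γ t)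

/-- The geodesic curvature `k_g = ⟨γ_ss, η⟩`, where `d/ds = (ds/dt)⁻¹ d/dt`. -/
def geodesicCurvature (γ : Circle → S2) (t : ℝ) : ℝ :=
  inner ℝ ((speed γ t)⁻¹ • deriv (tangent γ) t) (conormal γ t)

/-- The arclength integral `∫_γ f ds` of a function of the parameter. -/
def arcIntegral (γ : Circle → S2) (f : ℝ → ℝ) : ℝ :=
  ∫ t in (0 : ℝ)..(2 * Real.pi), f t * speed γ t

/-- The length of `γ`. -/
def length (γ : Circle → S2) : ℝ := arcIntegral γ (fun _ => 1)

/-- The area on the unit sphere (total mass `4π`). -/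
def area (Ω : Set S2) : ℝ :=
  (MeasureTheory.volume : MeasureTheory.Measure E3).toSphere.real Ω

/-- Smooth, regular, simple closed curves on the sphere. -/
structure IsSmoothSimpleClosed (γ : Circle → S2) : Prop where
  smooth : ContMDiff (𝓡 1) (𝓡 2) ∞ γ
  regular : ∀ t : ℝ, deriv (lift γ) t ≠ 0
  simple : Function.Injective γ

/-- `γ` is the positively oriented boundary of the domain `Ω ⊆ S²`: the domain is open and
connected, its boundary is the trace of `γ`, and it lies to the left of `γ` and not to the right,
as tested along the geodesics `ε ↦ cos ε γ + sin ε η` of the sphere normal to `γ`. -/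
structure IsPositiveBoundary (γ : Circle → S2) (Ω : Set S2) : Prop where
  isOpen : IsOpen Ω
  isConnected : IsConnected Ω
  frontier_eq : frontier Ω = Set.range γ
  left_mem : ∀ t : ℝ, ∀ᶠ ε in nhdsWithin (0 : ℝ) (Set.Ioi 0), ∀ x : S2,
    (x : E3) = Real.cos ε • lift γ t + Real.sin ε • conormal γ t → x ∈ Ω
  right_notMem : ∀ t : ℝ, ∀ᶠ ε in nhdsWithin (0 : ℝ) (Set.Ioi 0), ∀ x : S2,
    (x : E3) = Real.cos ε • lift γ t - Real.sin ε • conormal γ t → x ∉ Ω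

/-- Strict convexity of a positively oriented curve: the geodesic curvature is positive. -/
def IsStrictlyConvex (γ : Circle → S2) : Prop := ∀ t : ℝ, 0 < geodesicCurvature γ t

/-- The trace of `γ` is a geodesic circle: the set of all points at a fixed spherical distance
`r ∈ (0, π)` from a point `p` of the sphere. -/
def IsGeodesicCircle (γ : Circle → S2) : Prop :=
  ∃ p : S2, ∃ r ∈ Set.Ioo (0 : ℝ) Real.pi,
    Set.range γ = {x : S2 | InnerProductGeometry.angle (x : E3) (p : E3) = r}

/-- The denominator `√((1 + a²)(1 + b²)) + 1 + ab` in the remainder. -/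
def remainderDenom (a b : ℝ) : ℝ := √((1 + a ^ 2) * (1 + b ^ 2)) + 1 + a * b

/-- The remainder `R(γ)`. -/
def remainder (γ : Circle → S2) : ℝ :=
  arcIntegral γ fun s => arcIntegral γ fun σ =>
    (geodesicCurvature γ s - geodesicCurvature γ σ) ^ 2 /
      remainderDenom (geodesicCurvature γ s) (geodesicCurvature γ σ)

/-- The integral `∫_γ √(1 + k_g²) ds`. -/
def totalCurvature (γ : Circle → S2) : ℝ :=
  arcIntegral γ fun s => √(1 + geodesicCurvature γ s ^ 2)

end

end SphereCurve

/-! Write `K` for the integral of the geodesic curvature and `W` for that of `√(1 + k_g²)`.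
Gauss–Bonnet says `A = 2π - K`, so `A(4π - A) = 4π² - K²` and the claimed identity becomes `R = W² -
L² - K²`. This is algebra: rationalising the integrand of the remainder turns it into `√(1 + a²)√(1
+ b²) - 1 - ab`, whose double integral separates. The remainder vanishes exactly when `k_g` is
constant, which for a closed curve on the sphere means a geodesic circle.

The work lies in Gauss–Bonnet (`area_eq_two_pi_sub`), obtained by comparing volumes in the unit
ball. Let `C` be the open cone over `Ω`. Up to a null set the ball is the disjoint union of its
parts in `C`, in `-C`, and of the half-discs `aγ + bγ_s` with `b > 0`, one for each point of the
curve. The map `(t, a, b) ↦ aγ + bγ_s` has Jacobian `speed * k_g * b`, so the half-discs fill volume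
`2K/3`. As `A` is three times the volume of the part in `C`, `4π/3 = 2A/3 + 2K/3`.

The decomposition rests on convexity of `C` (`convex_cone`). Positive curvature makes the tangent
planes support `C` locally, with contact only along a ray (`eventually_local_support`). A
connectedness argument makes this global, once antipodal pairs in `C` are excluded
(`neg_notMem_cone`). Disjointness and covering are then `tangentMap_injective` and
`exists_tangentMap_eq`. -/

open scoped Pointwise

namespace SphereCurve

noncomputable section

open MeasureTheory

variable {γ : Circle → S2} {Ω : Set S2}

/-! ### The cross product -/

/-- The cross product on Euclidean three-space as a continuous bilinear map. -/
def crossCLM : E3 →L[ℝ] E3 →L[ℝ] E3 :=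
  LinearMap.toContinuousLinearMap
    ((LinearMap.toContinuousLinearMap : (E3 →ₗ[ℝ] E3) ≃ₗ[ℝ] (E3 →L[ℝ] E3)).toLinearMap ∘ₗ
      LinearMap.mk₂ ℝ cross
        (fun x y z => by simp [cross]) (fun c x y => by simp [cross])
        (fun x y z => by simp [cross]) (fun c x y => by simp [cross]))

theorem crossCLM_apply (x y : E3) : crossCLM x y = cross x y := rfl

theorem inner_eq_sum (x y : E3) : inner ℝ x y = x 0 * y 0 + x 1 * y 1 + x 2 * y 2 := by
  simp [PiLp.inner_apply, Fin.sum_univ_three, mul_comm]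

@[simp] theorem cross_apply_zero (x y : E3) : cross x y 0 = x 1 * y 2 - x 2 * y 1 := by
  simp [cross, crossProduct]

@[simp] theorem cross_apply_one (x y : E3) : cross x y 1 = x 2 * y 0 - x 0 * y 2 := by
  simp [cross, crossProduct]

@[simp] theorem cross_apply_two (x y : E3) : cross x y 2 = x 0 * y 1 - x 1 * y 0 := by
  simp [cross, crossProduct]

theorem inner_cross_self_left (x y : E3) : inner ℝ x (cross x y) = 0 := by
  simp only [inner_eq_sum, cross_apply_zero, cross_apply_one, cross_apply_two]; ring

theorem inner_cross_self_right (x y : E3) : inner ℝ y (cross x y) = 0 := by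
  simp only [inner_eq_sum, cross_apply_zero, cross_apply_one, cross_apply_two]; ring

theorem inner_cross_cyclic (x y z : E3) : inner ℝ x (cross y z) = inner ℝ y (cross z x) := by
  simp only [inner_eq_sum, cross_apply_zero, cross_apply_one, cross_apply_two]; ring

theorem inner_cross_swap (x y z : E3) : inner ℝ x (cross y z) = - inner ℝ x (cross z y) := by
  simp only [inner_eq_sum, cross_apply_zero, cross_apply_one, cross_apply_two]; ring

theorem cross_self (x : E3) : cross x x = 0 := by
  ext i; fin_cases i <;> simp [mul_comm]

theorem inner_cross_cross_self (x y : E3) :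
    inner ℝ (cross x y) (cross x y) = inner ℝ x x * inner ℝ y y - inner ℝ x y ^ 2 := by
  simp only [inner_eq_sum, cross_apply_zero, cross_apply_one, cross_apply_two]; ring

theorem cross_cross_self_left (x y : E3) :
    cross x (cross x y) = (inner ℝ x y : ℝ) • x - (inner ℝ x x : ℝ) • y := by
  rw [inner_eq_sum, inner_eq_sum]
  ext i; fin_cases i <;> simp <;> ring

/-- Two orthogonal unit vectors and their cross product form an orthonormal basis. -/
theorem eq_sum_inner_smul {a b : E3} (ha : inner ℝ a a = (1 : ℝ)) (hb : inner ℝ b b = (1 : ℝ))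
    (hab : inner ℝ a b = (0 : ℝ)) (x : E3) :
    x = (inner ℝ x a : ℝ) • a + (inner ℝ x b : ℝ) • b
      + (inner ℝ x (cross a b) : ℝ) • cross a b := by
  have hc : inner ℝ (cross a b) (cross a b) = (1 : ℝ) := by
    rw [inner_cross_cross_self, ha, hb, hab]; norm_num
  have hac := inner_cross_self_left a b
  have hbc := inner_cross_self_right a b
  have on : Orthonormal ℝ ![a, b, cross a b] := by
    rw [orthonormal_iff_ite]
    intro i j
    have hba : inner ℝ b a = (0 : ℝ) := by rw [real_inner_comm, hab]
    have hca : inner ℝ (cross a b) a = (0 : ℝ) := by rw [real_inner_comm, hac]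
    have hcb : inner ℝ (cross a b) b = (0 : ℝ) := by rw [real_inner_comm, hbc]
    fin_cases i <;> fin_cases j
    exacts [by simpa using ha, by simpa using hab, by simpa using hac, by simpa using hba,
      by simpa using hb, by simpa using hbc, by simpa using hca, by simpa using hcb,
      by simpa using hc]
  let B := (basisOfOrthonormalOfCardEqFinrank on (by simp)).toOrthonormalBasis
    (by simpa using on)
  have h := B.sum_repr' x
  simp only [Fin.sum_univ_three] at h
  have h0 : B 0 = a := by simp [B]
  have h1 : B 1 = b := by simp [B]
  have h2 : B 2 = cross a b := by simp [B]
  rw [h0, h1, h2] at h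
  rw [real_inner_comm a x, real_inner_comm b x, real_inner_comm (cross a b) x]
  exact h.symm

/-! ### The moving frame of a spherical curve -/

theorem contDiff_lift (hγ : IsSmoothSimpleClosed γ) : ContDiff ℝ ∞ (lift γ) := by
  have : Fact (Module.finrank ℝ E3 = 2 + 1) := ⟨by simp⟩
  rw [← contMDiff_iff_contDiff]
  exact (contMDiff_coe_sphere (E := E3) (n := 2)).comp (hγ.smooth.comp contMDiff_circleExp)

theorem lift_periodic (γ : Circle → S2) : Function.Periodic (lift γ) (2 * Real.pi) := by
  intro t; simp [lift]

theorem deriv_lift_periodic (γ : Circle → S2) :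
    Function.Periodic (deriv (lift γ)) (2 * Real.pi) := by
  intro t
  rw [← deriv_comp_add_const]
  congr 1
  exact funext (lift_periodic γ)

theorem speed_periodic (γ : Circle → S2) : Function.Periodic (speed γ) (2 * Real.pi) := by
  intro t; simp [speed, deriv_lift_periodic γ t]

theorem tangent_periodic (γ : Circle → S2) : Function.Periodic (tangent γ) (2 * Real.pi) := by
  intro t; simp [tangent, deriv_lift_periodic γ t, speed_periodic γ t]

theorem conormal_periodic (γ : Circle → S2) : Function.Periodic (conormal γ) (2 * Real.pi) := by
  intro t; simp [conormal, lift_periodic γ t, tangent_periodic γ t]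

theorem norm_lift (γ : Circle → S2) (t : ℝ) : ‖lift γ t‖ = 1 := by simp [lift]

theorem speed_pos (hγ : IsSmoothSimpleClosed γ) (t : ℝ) : 0 < speed γ t :=
  norm_pos_iff.2 (hγ.regular t)

theorem contDiff_deriv_lift (hγ : IsSmoothSimpleClosed γ) : ContDiff ℝ ∞ (deriv (lift γ)) :=
  (contDiff_infty_iff_deriv.1 (contDiff_lift hγ)).2

theorem contDiff_speed (hγ : IsSmoothSimpleClosed γ) : ContDiff ℝ ∞ (speed γ) :=
  (contDiff_deriv_lift hγ).norm ℝ hγ.regular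

theorem contDiff_tangent (hγ : IsSmoothSimpleClosed γ) : ContDiff ℝ ∞ (tangent γ) :=
  ((contDiff_speed hγ).inv fun t => (speed_pos hγ t).ne').smul (contDiff_deriv_lift hγ)

theorem contDiff_conormal (hγ : IsSmoothSimpleClosed γ) : ContDiff ℝ ∞ (conormal γ) :=
  (crossCLM.contDiff.comp (contDiff_lift hγ)).clm_apply (contDiff_tangent hγ)

theorem continuous_lift (hγ : IsSmoothSimpleClosed γ) : Continuous (lift γ) :=
  (contDiff_lift hγ).continuous

theorem continuous_speed (hγ : IsSmoothSimpleClosed γ) : Continuous (speed γ) :=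
  (contDiff_speed hγ).continuous

theorem continuous_conormal (hγ : IsSmoothSimpleClosed γ) : Continuous (conormal γ) :=
  (contDiff_conormal hγ).continuous

theorem continuous_geodesicCurvature (hγ : IsSmoothSimpleClosed γ) :
    Continuous (geodesicCurvature γ) := by
  have h := (contDiff_infty_iff_deriv.1 (contDiff_tangent hγ)).2.continuous
  exact (((continuous_speed hγ).inv₀ fun t => (speed_pos hγ t).ne').smul h).inner
    (continuous_conormal hγ)

theorem inner_lift_lift (γ : Circle → S2) (t : ℝ) : inner ℝ (lift γ t) (lift γ t) = (1 : ℝ) := by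
  rw [real_inner_self_eq_norm_sq, norm_lift]; norm_num

theorem hasDerivAt_lift (hγ : IsSmoothSimpleClosed γ) (t : ℝ) :
    HasDerivAt (lift γ) (speed γ t • tangent γ t) t := by
  have : speed γ t • tangent γ t = deriv (lift γ) t := by
    rw [tangent, smul_smul, mul_inv_cancel₀ (speed_pos hγ t).ne', one_smul]
  rw [this]
  exact ((contDiff_lift hγ).differentiable (by simp) t).hasDerivAt

theorem inner_tangent_tangent (hγ : IsSmoothSimpleClosed γ) (t : ℝ) :
    inner ℝ (tangent γ t) (tangent γ t) = (1 : ℝ) := by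
  have h : ‖tangent γ t‖ = 1 := by
    rw [tangent, norm_smul, norm_inv, Real.norm_of_nonneg (speed_pos hγ t).le]
    exact inv_mul_cancel₀ (speed_pos hγ t).ne'
  rw [real_inner_self_eq_norm_sq, h]; norm_num

theorem inner_eq_zero_of_inner_self_const {f : ℝ → E3} {f' : E3} {t c : ℝ}
    (hf : HasDerivAt f f' t) (h : ∀ t, inner ℝ (f t) (f t) = c) : inner ℝ (f t) f' = (0 : ℝ) := by
  have h1 := hf.inner ℝ hf
  rw [funext h] at h1
  have h2 := h1.unique (hasDerivAt_const t c)
  rw [real_inner_comm (f t) f'] at h2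
  linarith

theorem inner_lift_tangent (hγ : IsSmoothSimpleClosed γ) (t : ℝ) :
    inner ℝ (lift γ t) (tangent γ t) = (0 : ℝ) := by
  have h := inner_eq_zero_of_inner_self_const (hasDerivAt_lift hγ t) (inner_lift_lift γ)
  rw [inner_smul_right] at h
  exact (mul_eq_zero.1 h).resolve_left (speed_pos hγ t).ne'

theorem inner_lift_conormal (γ : Circle → S2) (t : ℝ) :
    inner ℝ (lift γ t) (conormal γ t) = (0 : ℝ) := inner_cross_self_left _ _

theorem inner_tangent_conormal (γ : Circle → S2) (t : ℝ) :
    inner ℝ (tangent γ t) (conormal γ t) = (0 : ℝ) := inner_cross_self_right _ _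

theorem inner_conormal_conormal (hγ : IsSmoothSimpleClosed γ) (t : ℝ) :
    inner ℝ (conormal γ t) (conormal γ t) = (1 : ℝ) := by
  rw [conormal, inner_cross_cross_self, inner_lift_lift, inner_tangent_tangent hγ,
    inner_lift_tangent hγ]; norm_num

theorem frame_expansion (hγ : IsSmoothSimpleClosed γ) (t : ℝ) (x : E3) :
    x = (inner ℝ x (lift γ t) : ℝ) • lift γ t + (inner ℝ x (tangent γ t) : ℝ) • tangent γ t
      + (inner ℝ x (conormal γ t) : ℝ) • conormal γ t :=
  eq_sum_inner_smul (inner_lift_lift γ t) (inner_tangent_tangent hγ t) (inner_lift_tangent hγ t) x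

/-- Read off in the moving frame: the component along `γ_s` vanishes because `γ_s` has unit length,
the one along `γ` comes from differentiating `⟨γ, γ_s⟩ = 0`, and the one along `η` is the definition
of `k_g`. -/
theorem hasDerivAt_tangent (hγ : IsSmoothSimpleClosed γ) (t : ℝ) :
    HasDerivAt (tangent γ)
      (speed γ t • (- lift γ t + geodesicCurvature γ t • conormal γ t)) t := by
  have hT := ((contDiff_tangent hγ).differentiable (by simp) t).hasDerivAt
  have hv := (speed_pos hγ t).ne'
  have h1 : inner ℝ (deriv (tangent γ) t) (tangent γ t) = (0 : ℝ) := by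
    rw [real_inner_comm]
    exact inner_eq_zero_of_inner_self_const hT (inner_tangent_tangent hγ)
  have h2 : inner ℝ (deriv (tangent γ) t) (lift γ t) = - speed γ t := by
    have h := (hasDerivAt_lift hγ t).inner ℝ hT
    rw [funext (inner_lift_tangent hγ)] at h
    have h3 := h.unique (hasDerivAt_const t (0 : ℝ))
    rw [inner_smul_left, inner_tangent_tangent hγ] at h3
    simp only [conj_trivial, mul_one] at h3
    rw [real_inner_comm]; linarith
  have h4 : inner ℝ (deriv (tangent γ) t) (conormal γ t) = speed γ t * geodesicCurvature γ t := by
    rw [geodesicCurvature, inner_smul_left]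
    simp only [conj_trivial]
    rw [← mul_assoc, mul_inv_cancel₀ hv, one_mul]
  have h5 := frame_expansion hγ t (deriv (tangent γ) t)
  rw [h1, h2, h4] at h5
  refine hT.congr_deriv (h5.trans ?_)
  module

theorem hasDerivAt_conormal (hγ : IsSmoothSimpleClosed γ) (t : ℝ) :
    HasDerivAt (conormal γ) (-(speed γ t * geodesicCurvature γ t) • tangent γ t) t := by
  have h := (crossCLM.hasFDerivAt.comp_hasDerivAt t (hasDerivAt_lift hγ t)).clm_apply
    (hasDerivAt_tangent hγ t)
  refine h.congr_deriv ?_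
  simp only [Function.comp_apply, map_smul, map_add, map_neg, crossCLM_apply,
    smul_apply, cross_self, conormal]
  rw [cross_cross_self_left, inner_lift_tangent hγ, inner_lift_lift]
  module

theorem geodesicCurvature_periodic (γ : Circle → S2) :
    Function.Periodic (geodesicCurvature γ) (2 * Real.pi) := by
  intro t
  have h : deriv (tangent γ) (t + 2 * Real.pi) = deriv (tangent γ) t := by
    rw [← deriv_comp_add_const]
    congr 1
    exact funext (tangent_periodic γ)
  simp [geodesicCurvature, h, speed_periodic γ t, conormal_periodic γ t]

/-! ### The cone over a spherical domain -/

/-- The open cone in Euclidean space over a subset of the sphere. -/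
def cone (Ω : Set S2) : Set E3 := {x | ∃ y ∈ Ω, ∃ r : ℝ, 0 < r ∧ x = r • (y : E3)}

theorem smul_mem_cone {x : E3} (hx : x ∈ cone Ω) {c : ℝ} (hc : 0 < c) : c • x ∈ cone Ω := by
  obtain ⟨y, hy, r, hr, rfl⟩ := hx
  exact ⟨y, hy, c * r, mul_pos hc hr, smul_smul _ _ _⟩

theorem smul_mem_cone_iff {x : E3} {c : ℝ} (hc : 0 < c) : c • x ∈ cone Ω ↔ x ∈ cone Ω := by
  refine ⟨fun h => ?_, fun h => smul_mem_cone h hc⟩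
  simpa [smul_smul, inv_mul_cancel₀ hc.ne'] using smul_mem_cone h (inv_pos.2 hc)

theorem smul_mem_closure_cone {x : E3} (hx : x ∈ closure (cone Ω)) {c : ℝ} (hc : 0 < c) :
    c • x ∈ closure (cone Ω) :=
  map_mem_closure (continuous_const_smul c) hx fun _ h => smul_mem_cone h hc

theorem norm_coe (y : S2) : ‖(y : E3)‖ = 1 := by simp

theorem coe_mem_cone_iff (y : S2) : (y : E3) ∈ cone Ω ↔ y ∈ Ω := by
  constructor
  · rintro ⟨z, hz, r, hr, h⟩
    have h1 := congrArg norm h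
    rw [norm_smul, norm_coe, norm_coe, Real.norm_of_nonneg hr.le, mul_one] at h1
    rw [← h1, one_smul] at h
    rwa [Subtype.ext h]
  · exact fun h => ⟨y, h, 1, one_pos, (one_smul _ _).symm⟩

theorem ne_zero_of_mem_cone {x : E3} (hx : x ∈ cone Ω) : x ≠ 0 := by
  obtain ⟨y, _, r, hr, rfl⟩ := hx
  intro h
  have h1 := congrArg norm h
  rw [norm_smul, norm_coe, Real.norm_of_nonneg hr.le, norm_zero, mul_one] at h1
  exact hr.ne' h1

theorem isOpen_cone (hΩ : IsOpen Ω) : IsOpen (cone Ω) := by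
  have h := (isOpen_Ioi (a := (0 : ℝ))).smul_sphere (E := E3) one_ne_zero (by simp) hΩ
  suffices heq : cone Ω = Set.Ioi (0 : ℝ) • (Subtype.val '' Ω : Set E3) from heq ▸ h
  ext x
  constructor
  · rintro ⟨y, hy, r, hr, rfl⟩
    exact Set.smul_mem_smul hr (Set.mem_image_of_mem _ hy)
  · intro hx
    obtain ⟨r, hr, _, ⟨y, hy, rfl⟩, rfl⟩ := Set.mem_smul.1 hx
    exact ⟨y, hy, r, hr, rfl⟩

theorem isPreconnected_cone (hΩ : IsPreconnected Ω) : IsPreconnected (cone Ω) := by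
  have h := (hΩ.prod (isPreconnected_Ioi (a := (0 : ℝ)))).image
    (fun z : S2 × ℝ => z.2 • (z.1 : E3)) (by fun_prop)
  convert h using 1
  ext x
  constructor
  · rintro ⟨y, hy, r, hr, rfl⟩
    exact ⟨(y, r), ⟨hy, hr⟩, rfl⟩
  · rintro ⟨⟨y, r⟩, ⟨hy, hr⟩, rfl⟩
    exact ⟨y, hy, r, hr, rfl⟩

theorem exists_smul_coe {x : E3} (hx : x ≠ 0) :
    ∃ y : S2, (y : E3) = ‖x‖⁻¹ • x ∧ x = ‖x‖ • (y : E3) := by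
  have h : ‖x‖ ≠ 0 := norm_ne_zero_iff.2 hx
  refine ⟨⟨‖x‖⁻¹ • x, ?_⟩, rfl, ?_⟩
  · rw [mem_sphere_zero_iff_norm, norm_smul, norm_inv, norm_norm, inv_mul_cancel₀ h]
  · simp [smul_smul, mul_inv_cancel₀ h]

theorem exists_lift_eq (γ : Circle → S2) (z : Circle) : ∃ t, lift γ t = γ z ∧ Circle.exp t = z := by
  obtain ⟨t, rfl⟩ := Circle.exp_surjective z
  exact ⟨t, rfl, rfl⟩

theorem lift_mem_closure_cone (hΩ : IsPositiveBoundary γ Ω) (t : ℝ) :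
    lift γ t ∈ closure (cone Ω) := by
  have h : γ (Circle.exp t) ∈ closure Ω :=
    frontier_subset_closure (hΩ.frontier_eq ▸ Set.mem_range_self _)
  exact map_mem_closure (f := (Subtype.val : S2 → E3)) continuous_subtype_val h fun y hy => (coe_mem_cone_iff y).2 hy

theorem lift_notMem_cone (hΩ : IsPositiveBoundary γ Ω) (t : ℝ) : lift γ t ∉ cone Ω := by
  have h : γ (Circle.exp t) ∈ frontier Ω := hΩ.frontier_eq ▸ Set.mem_range_self _
  rw [hΩ.isOpen.frontier_eq] at h
  exact fun h' => h.2 ((coe_mem_cone_iff _).1 h')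

/-- Away from the apex, radial projection to the sphere is continuous and sends the closure of the
cone into the closure of `Ω`; the frontier of `Ω` is the curve. -/
theorem exists_smul_lift_of_mem_closure_cone (hΩ : IsPositiveBoundary γ Ω) {x : E3}
    (hx : x ∈ closure (cone Ω)) (hxc : x ∉ cone Ω) (hx0 : x ≠ 0) :
    ∃ t : ℝ, ∃ r : ℝ, 0 < r ∧ x = r • lift γ t := by
  have hn : 0 < ‖x‖ := norm_pos_iff.2 hx0
  obtain ⟨y, hy, hxy⟩ := exists_smul_coe hx0
  have hyΩ : y ∉ Ω := fun h => hxc (hxy ▸ smul_mem_cone ((coe_mem_cone_iff y).2 h) hn)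
  have hycl : y ∈ closure Ω := by
    rw [closure_subtype, hy]
    have hc : ContinuousWithinAt (fun x : E3 => ‖x‖⁻¹ • x) (cone Ω) x :=
      ((continuous_norm.continuousAt.inv₀ hn.ne').smul continuousAt_id).continuousWithinAt
    refine hc.mem_closure hx ?_
    rintro _ ⟨z, hz, r, hr, rfl⟩
    refine ⟨z, hz, ?_⟩
    simp only [norm_smul, norm_coe, Real.norm_of_nonneg hr.le, mul_one, smul_smul,
      inv_mul_cancel₀ hr.ne', one_smul]
  have hyf : y ∈ Set.range γ := by
    rw [← hΩ.frontier_eq, hΩ.isOpen.frontier_eq]; exact ⟨hycl, hyΩ⟩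
  obtain ⟨z, rfl⟩ := hyf
  obtain ⟨t, ht, _⟩ := exists_lift_eq γ z
  exact ⟨t, ‖x‖, hn, by rw [ht]; exact hxy⟩

/-! ### Local strict support -/

/-- By the mean value theorem. Together with `pos_of_deriv_mul_sub_pos` this replaces the second
derivative test: it is applied to `⟨γ_s, η(t₀)⟩`, which is the derivative of `⟨γ, η(t₀)⟩` only up to
the positive factor `speed`. -/
theorem mul_sub_pos_of_deriv_pos {f f' : ℝ → ℝ} (hf : ∀ t, HasDerivAt f (f' t) t) {a δ : ℝ}
    (ha : f a = 0) (hpos : ∀ t, |t - a| < δ → t ≠ a → 0 < f' t) {t : ℝ} (ht : |t - a| < δ)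
    (hta : t ≠ a) : 0 < f t * (t - a) := by
  have hc : Continuous f := continuous_iff_continuousAt.2 fun t => (hf t).continuousAt
  rw [abs_lt] at ht
  rcases lt_or_gt_of_ne hta with h | h
  · obtain ⟨c, ⟨hc1, hc2⟩, hc3⟩ := exists_hasDerivAt_eq_slope f f' h hc.continuousOn
      fun x _ => hf x
    have h1 := hpos c (by rw [abs_lt]; constructor <;> linarith) hc2.ne
    rw [hc3, ha, lt_div_iff₀ (by linarith)] at h1
    nlinarith
  · obtain ⟨c, ⟨hc1, hc2⟩, hc3⟩ := exists_hasDerivAt_eq_slope f f' h hc.continuousOn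
      fun x _ => hf x
    have h1 := hpos c (by rw [abs_lt]; constructor <;> linarith) hc1.ne'
    rw [hc3, ha, lt_div_iff₀ (by linarith)] at h1
    nlinarith

theorem pos_of_deriv_mul_sub_pos {f f' : ℝ → ℝ} (hf : ∀ t, HasDerivAt f (f' t) t) {a δ : ℝ}
    (ha : f a = 0) (hpos : ∀ t, |t - a| < δ → t ≠ a → 0 < f' t * (t - a)) {t : ℝ}
    (ht : |t - a| < δ) (hta : t ≠ a) : 0 < f t := by
  have hc : Continuous f := continuous_iff_continuousAt.2 fun t => (hf t).continuousAt
  rw [abs_lt] at ht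
  rcases lt_or_gt_of_ne hta with h | h
  · obtain ⟨c, ⟨hc1, hc2⟩, hc3⟩ := exists_hasDerivAt_eq_slope f f' h hc.continuousOn
      fun x _ => hf x
    have h1 := hpos c (by rw [abs_lt]; constructor <;> linarith) hc2.ne
    have h2 : f' c < 0 := by nlinarith
    rw [hc3, ha, div_lt_iff₀ (by linarith)] at h2
    linarith
  · obtain ⟨c, ⟨hc1, hc2⟩, hc3⟩ := exists_hasDerivAt_eq_slope f f' h hc.continuousOn
      fun x _ => hf x
    have h1 := hpos c (by rw [abs_lt]; constructor <;> linarith) hc1.ne'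
    have h2 : 0 < f' c := by nlinarith
    rw [hc3, ha, lt_div_iff₀ (by linarith)] at h2
    linarith

/-- A strictly convex curve lies locally strictly on the inner side of its tangent plane. -/
theorem eventually_inner_lift_conormal_pos (hγ : IsSmoothSimpleClosed γ)
    (hconv : IsStrictlyConvex γ) (t₀ : ℝ) :
    ∀ᶠ t in nhds t₀, t ≠ t₀ → 0 < inner ℝ (lift γ t) (conormal γ t₀) := by
  have hT : ∀ t, HasDerivAt (fun t => inner ℝ (tangent γ t) (conormal γ t₀) : ℝ → ℝ)
      (speed γ t * (- inner ℝ (lift γ t) (conormal γ t₀)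
        + geodesicCurvature γ t * inner ℝ (conormal γ t) (conormal γ t₀))) t := by
    intro t
    refine ((hasDerivAt_tangent hγ t).inner ℝ (hasDerivAt_const t (conormal γ t₀))).congr_deriv ?_
    simp only [inner_zero_right, inner_smul_left, inner_add_left, inner_neg_left, conj_trivial]
    ring
  have hL : ∀ t, HasDerivAt (fun t => inner ℝ (lift γ t) (conormal γ t₀) : ℝ → ℝ)
      (speed γ t * inner ℝ (tangent γ t) (conormal γ t₀)) t := by
    intro t
    refine ((hasDerivAt_lift hγ t).inner ℝ (hasDerivAt_const t (conormal γ t₀))).congr_deriv ?_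
    simp only [inner_zero_right, inner_smul_left, conj_trivial]
    ring
  have hcont : Continuous fun t => speed γ t * (- inner ℝ (lift γ t) (conormal γ t₀)
        + geodesicCurvature γ t * inner ℝ (conormal γ t) (conormal γ t₀)) :=
    (continuous_speed hγ).mul (((continuous_lift hγ).inner continuous_const).neg.add
      ((continuous_geodesicCurvature hγ).mul ((continuous_conormal hγ).inner continuous_const)))
  have h0 : 0 < speed γ t₀ * (- inner ℝ (lift γ t₀) (conormal γ t₀)
        + geodesicCurvature γ t₀ * inner ℝ (conormal γ t₀) (conormal γ t₀)) := by
    rw [inner_lift_conormal, inner_conormal_conormal hγ]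
    have := mul_pos (speed_pos hγ t₀) (hconv t₀)
    simpa using this
  obtain ⟨δ, hδ, hball⟩ := Metric.eventually_nhds_iff.1
    (hcont.continuousAt.eventually (lt_mem_nhds h0))
  refine Metric.eventually_nhds_iff.2 ⟨δ, hδ, fun t ht hne => ?_⟩
  refine pos_of_deriv_mul_sub_pos hL (inner_lift_conormal γ t₀) (δ := δ) ?_ ht hne
  intro s hs hsne
  rw [mul_assoc]
  exact mul_pos (speed_pos hγ s) (mul_sub_pos_of_deriv_pos hT (inner_tangent_conormal γ t₀)
    (fun u hu _ => hball hu) hs hsne)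

/-- Points of the cone over the curve near `lift γ t₀` come from nearby parameters. -/
theorem eventually_parameter_close (hγ : IsSmoothSimpleClosed γ) (t₀ : ℝ) {δ : ℝ} (hδ : 0 < δ) :
    ∀ᶠ x in nhds (lift γ t₀), ∀ t r : ℝ, 0 < r → x = r • lift γ t →
      ∃ s, lift γ s = lift γ t ∧ |s - t₀| < δ ∧ |r - 1| < δ := by
  -- A continuous injection of the compact circle is an embedding, so nearby points of the curve
  -- come from nearby points of the circle. `Circle.exp` is open, which yields a close parameter
  -- `s`; the given `t` may differ from it by a period.
  have hemb : Topology.IsEmbedding (fun z : Circle => (γ z : E3)) :=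
    (Continuous.isClosedEmbedding (continuous_subtype_val.comp hγ.smooth.continuous)
      (Subtype.val_injective.comp hγ.simple)).isEmbedding
  have hN : Circle.exp '' (Metric.ball t₀ δ) ∈ nhds (Circle.exp t₀) :=
    isLocalHomeomorph_circleExp.isOpenMap.image_mem_nhds (Metric.ball_mem_nhds t₀ hδ)
  rw [hemb.nhds_eq_comap, Filter.mem_comap] at hN
  obtain ⟨M, hM, hMsub⟩ := hN
  have hn : ‖lift γ t₀‖ ≠ 0 := by simp [norm_lift]
  have hc : ContinuousAt (fun x : E3 => ‖x‖⁻¹ • x) (lift γ t₀) :=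
    (continuous_norm.continuousAt.inv₀ hn).smul continuousAt_id
  have hM' : M ∈ nhds (‖lift γ t₀‖⁻¹ • lift γ t₀) := by
    rw [norm_lift, inv_one, one_smul]; exact hM
  have hc2 : ∀ᶠ x in nhds (lift γ t₀), |‖x‖ - 1| < δ := by
    have : ContinuousAt (fun x : E3 => |‖x‖ - 1|) (lift γ t₀) := by fun_prop
    refine this.eventually (gt_mem_nhds ?_)
    simpa [norm_lift] using hδ
  filter_upwards [hc.eventually hM', hc2] with x hx hx2 t r hr hxr
  have hxn : ‖x‖ = r := by
    rw [hxr, norm_smul, norm_lift, mul_one, Real.norm_of_nonneg hr.le]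
  rw [hxn] at hx hx2
  have h1 : (γ (Circle.exp t) : E3) ∈ M := by
    have : r⁻¹ • x = lift γ t := by rw [hxr, smul_smul, inv_mul_cancel₀ hr.ne', one_smul]
    rw [this] at hx
    exact hx
  obtain ⟨s, hs, hst⟩ := hMsub h1
  exact ⟨s, by simp [lift, hst], hs, hx2⟩

/-- Normal coordinates along the curve, extended radially. -/
def normalCoord (γ : Circle → S2) (z : ℝ × ℝ × ℝ) : E3 :=
  z.2.2 • (lift γ z.1 + z.2.1 • conormal γ z.1)

theorem inner_normalCoord_lift (γ : Circle → S2) (z : ℝ × ℝ × ℝ) :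
    inner ℝ (normalCoord γ z) (lift γ z.1) = z.2.2 := by
  rw [normalCoord, inner_smul_left, inner_add_left, inner_smul_left, inner_lift_lift,
    real_inner_comm, inner_lift_conormal]
  simp

/-- The partial derivatives at the base point are `speed • γ_s`, `η` and `γ`, which are independent;
the inverse function theorem then makes `normalCoord` a local chart. -/
theorem exists_hasStrictFDerivAt_normalCoord (hγ : IsSmoothSimpleClosed γ) (t₀ : ℝ) :
    ∃ e : (ℝ × ℝ × ℝ) ≃L[ℝ] E3,
      HasStrictFDerivAt (normalCoord γ) (e : (ℝ × ℝ × ℝ) →L[ℝ] E3) (t₀, 0, 1) := by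
  have hsm : ContDiff ℝ ∞ (normalCoord γ) :=
    contDiff_snd.snd.smul (((contDiff_lift hγ).comp contDiff_fst).add
      (contDiff_snd.fst.smul ((contDiff_conormal hγ).comp contDiff_fst)))
  have hstr := hsm.contDiffAt.hasStrictFDerivAt (x := (t₀, 0, 1)) (by simp)
  set D := fderiv ℝ (normalCoord γ) (t₀, 0, 1)
  have hDapp : ∀ a b c : ℝ, D (a, b, c) =
      (a * speed γ t₀) • tangent γ t₀ + b • conormal γ t₀ + c • lift γ t₀ := by
    intro a b c
    have hline : HasDerivAt (fun u : ℝ => ((t₀, 0, 1) : ℝ × ℝ × ℝ) + u • (a, b, c)) (a, b, c) 0 := by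
      simpa using ((hasDerivAt_id (0 : ℝ)).smul_const ((a, b, c) : ℝ × ℝ × ℝ)).const_add (t₀, 0, 1)
    have h1 := hstr.hasFDerivAt.comp_hasDerivAt_of_eq (0 : ℝ) hline (by simp)
    have ht : HasDerivAt (fun u : ℝ => t₀ + u * a) a 0 := by
      simpa using ((hasDerivAt_id (0 : ℝ)).mul_const a).const_add t₀
    have hL := (hasDerivAt_lift hγ t₀).scomp_of_eq (0 : ℝ) ht (by simp)
    have hE := (hasDerivAt_conormal hγ t₀).scomp_of_eq (0 : ℝ) ht (by simp)
    have hb : HasDerivAt (fun u : ℝ => u * b) b 0 := by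
      simpa using (hasDerivAt_id (0 : ℝ)).mul_const b
    have hc : HasDerivAt (fun u : ℝ => 1 + u * c) c 0 := by
      simpa using ((hasDerivAt_id (0 : ℝ)).mul_const c).const_add 1
    have h2 := hc.smul (hL.add (hb.smul hE))
    have h3 : (normalCoord γ ∘ fun u : ℝ => ((t₀, 0, 1) : ℝ × ℝ × ℝ) + u • (a, b, c))
        = fun u : ℝ => (1 + u * c) • (lift γ (t₀ + u * a) + (u * b) • conormal γ (t₀ + u * a)) := by
      funext u
      simp [normalCoord]
    rw [h3] at h1
    rw [h1.unique h2]
    simp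
    module
  have hinj : Function.Injective (D : (ℝ × ℝ × ℝ) →ₗ[ℝ] E3) := by
    rw [← LinearMap.ker_eq_bot, LinearMap.ker_eq_bot']
    rintro ⟨a, b, c⟩ h
    have h' : (a * speed γ t₀) • tangent γ t₀ + b • conormal γ t₀ + c • lift γ t₀ = 0 := by
      rw [← hDapp]; exact h
    have hT := congrArg (fun x => (inner ℝ x (tangent γ t₀) : ℝ)) h'
    have hE := congrArg (fun x => (inner ℝ x (conormal γ t₀) : ℝ)) h'
    have hL := congrArg (fun x => (inner ℝ x (lift γ t₀) : ℝ)) h'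
    simp only [inner_add_left, inner_smul_left, inner_zero_left, conj_trivial,
      inner_tangent_tangent hγ, inner_conormal_conormal hγ, inner_lift_lift, inner_lift_tangent hγ,
      inner_lift_conormal, inner_tangent_conormal, real_inner_comm (tangent γ t₀) (conormal γ t₀),
      real_inner_comm (lift γ t₀) (tangent γ t₀), real_inner_comm (lift γ t₀) (conormal γ t₀)]
      at hT hE hL
    have ha : a = 0 := by
      have : a * speed γ t₀ = 0 := by linarith
      exact (mul_eq_zero.1 this).resolve_right (speed_pos hγ t₀).ne'
    have hb : b = 0 := by linarith
    have hc : c = 0 := by linarith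
    rw [ha, hb, hc]; rfl
  let e := (LinearMap.linearEquivOfInjective (D : (ℝ × ℝ × ℝ) →ₗ[ℝ] E3) hinj
    (by simp)).toContinuousLinearEquiv
  have heD : (e : (ℝ × ℝ × ℝ) →L[ℝ] E3) = D := ContinuousLinearMap.ext fun z => rfl
  exact ⟨e, heD ▸ hstr⟩

/-- The side of the curve to which the conormal does not point is locally outside the domain. -/
theorem exists_ball_normalCoord (hγ : IsSmoothSimpleClosed γ) (hΩ : IsPositiveBoundary γ Ω)
    (t₀ : ℝ) : ∃ δ > 0, ∀ z ∈ Metric.ball ((t₀, 0, 1) : ℝ × ℝ × ℝ) δ,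
      normalCoord γ z ∈ closure (cone Ω) → 0 ≤ z.2.1 := by
  obtain ⟨e, he⟩ := exists_hasStrictFDerivAt_normalCoord hγ t₀
  set Φ := he.toOpenPartialHomeomorph (normalCoord γ) with hΦ
  have hΦc : ∀ z, Φ z = normalCoord γ z := fun z => rfl
  have hsrc : Φ.source ∈ nhds ((t₀, 0, 1) : ℝ × ℝ × ℝ) :=
    Φ.open_source.mem_nhds he.mem_toOpenPartialHomeomorph_source
  obtain ⟨δ₁, hδ₁, hball₁⟩ := Metric.mem_nhds_iff.1 hsrc
  have h0 : normalCoord γ (t₀, 0, 1) = lift γ t₀ := by simp [normalCoord]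
  have hclose := eventually_parameter_close hγ t₀ hδ₁
  rw [← h0] at hclose
  have hclose' := he.continuousAt.eventually hclose
  have hr : ∀ᶠ z in nhds ((t₀, 0, 1) : ℝ × ℝ × ℝ), 0 < z.2.2 :=
    (continuous_snd.snd.continuousAt).eventually (lt_mem_nhds (by norm_num))
  obtain ⟨δ, hδ, hball⟩ := Metric.mem_nhds_iff.1 (Filter.inter_mem hsrc
    (Filter.inter_mem hclose' hr))
  refine ⟨δ, hδ, fun z hz hzcl => ?_⟩
  by_contra! hneg
  -- The right half of the chart is connected and its image avoids the frontier of the cone, so one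
  -- point inside the cone would put all of it inside, against the hypothesis on the right side of
  -- the curve.
  set H : Set (ℝ × ℝ × ℝ) := Metric.ball ((t₀, 0, 1) : ℝ × ℝ × ℝ) δ ∩ {z | z.2.1 < 0} with hH
  have hHconv : Convex ℝ H := (convex_ball _ _).inter
    (convex_halfSpace_lt (f := fun z : ℝ × ℝ × ℝ => z.2.1)
      ⟨fun _ _ => rfl, fun _ _ => rfl⟩ 0)
  have hcontΦ : Continuous (normalCoord γ) := by
    have := continuous_lift hγ
    have := continuous_conormal hγ
    unfold normalCoord
    fun_prop
  have hpre : IsPreconnected (normalCoord γ '' H) :=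
    hHconv.isPreconnected.image _ hcontΦ.continuousOn
  -- A frontier point is some `r • γ(s)`, with chart coordinates `(s, 0, r)`; injectivity of the
  -- chart contradicts a negative middle coordinate.
  have hmiss : ∀ w ∈ H, normalCoord γ w ∈ closure (cone Ω) → normalCoord γ w ∈ cone Ω := by
    intro w hw hwcl
    by_contra hwc
    obtain ⟨hw1, hw2, hw3⟩ := hball hw.1
    have hne : normalCoord γ w ≠ 0 := by
      intro h
      have h2 := inner_normalCoord_lift γ w
      rw [h, inner_zero_left] at h2
      exact (ne_of_gt hw3) h2.symm
    obtain ⟨t, r, hrpos, hwr⟩ := exists_smul_lift_of_mem_closure_cone hΩ hwcl hwc hne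
    obtain ⟨s, hs, hs1, hs2⟩ := hw2 t r hrpos hwr
    have hmem : ((s, 0, r) : ℝ × ℝ × ℝ) ∈ Φ.source := by
      apply hball₁
      simp [Prod.dist_eq, Real.dist_eq, hs1, hs2]
    have heq : Φ w = Φ (s, 0, r) := by
      rw [hΦc, hΦc, hwr]
      simp [normalCoord, hs]
    have := Φ.injOn hw1 hmem heq
    have hlt : w.2.1 < 0 := hw.2
    rw [this] at hlt
    exact lt_irrefl _ hlt
  have hright : ∃ w ∈ H, normalCoord γ w ∉ cone Ω := by
    -- These are the chart coordinates of `cos ε γ - sin ε η`, since `cos ε (γ - tan ε η)` is that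
    -- point.
    have hc : ContinuousAt (fun ε : ℝ => ((t₀, -Real.tan ε, Real.cos ε) : ℝ × ℝ × ℝ)) 0 :=
      continuousAt_const.prodMk
        ((Real.continuousAt_tan.2 (by simp)).neg.prodMk Real.continuous_cos.continuousAt)
    have hb : Metric.ball ((t₀, 0, 1) : ℝ × ℝ × ℝ) δ ∈
        nhds ((t₀, -Real.tan 0, Real.cos 0) : ℝ × ℝ × ℝ) := by
      simpa using Metric.ball_mem_nhds _ hδ
    have hev := (hc.eventually hb).filter_mono (nhdsWithin_le_nhds (s := Set.Ioi 0))
    have hsmall : ∀ᶠ ε in nhdsWithin (0 : ℝ) (Set.Ioi 0), ε ∈ Set.Ioo 0 (Real.pi / 2) :=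
      Ioo_mem_nhdsGT (by positivity)
    obtain ⟨ε, hε1, hε2, hε3⟩ := ((hΩ.right_notMem t₀).and (hev.and hsmall)).exists
    have hcos : 0 < Real.cos ε := Real.cos_pos_of_mem_Ioo ⟨by linarith [hε3.1, Real.pi_pos], hε3.2⟩
    have htan : 0 < Real.tan ε := Real.tan_pos_of_pos_of_lt_pi_div_two hε3.1 hε3.2
    refine ⟨_, ⟨hε2, by simpa using htan⟩, ?_⟩
    have hval : normalCoord γ (t₀, -Real.tan ε, Real.cos ε) =
        Real.cos ε • lift γ t₀ - Real.sin ε • conormal γ t₀ := by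
      rw [Real.tan_eq_sin_div_cos]
      simp only [normalCoord, smul_add, smul_smul]
      rw [show Real.cos ε * -(Real.sin ε / Real.cos ε) = - Real.sin ε by field_simp]
      module
    have hnorm : ‖Real.cos ε • lift γ t₀ - Real.sin ε • conormal γ t₀‖ = 1 := by
      have h1 : ‖Real.cos ε • lift γ t₀ - Real.sin ε • conormal γ t₀‖ ^ 2 = 1 := by
        rw [← real_inner_self_eq_norm_sq]
        simp only [inner_sub_left, inner_sub_right, inner_smul_left, inner_smul_right,
          conj_trivial, inner_lift_lift, inner_lift_conormal, inner_conormal_conormal hγ,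
          real_inner_comm (lift γ t₀) (conormal γ t₀)]
        nlinarith [Real.sin_sq_add_cos_sq ε]
      nlinarith [norm_nonneg (Real.cos ε • lift γ t₀ - Real.sin ε • conormal γ t₀)]
    rw [hval]
    intro hmem
    exact hε1 ⟨_, mem_sphere_zero_iff_norm.2 hnorm⟩ rfl ((coe_mem_cone_iff (Ω := Ω)
      ⟨_, mem_sphere_zero_iff_norm.2 hnorm⟩).1 hmem)
  obtain ⟨w, hwH, hw⟩ := hright
  have hzH : z ∈ H := ⟨hz, hneg⟩
  have hsub : normalCoord γ '' H ⊆ cone Ω := by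
    refine hpre.subset_of_closure_inter_subset (isOpen_cone hΩ.isOpen)
      ⟨_, ⟨z, hzH, rfl⟩, hmiss z hzH hzcl⟩ ?_
    rintro _ ⟨hcl, u, huH, rfl⟩
    exact hmiss u huH hcl
  exact hw (hsub ⟨w, hwH, rfl⟩)

/-- The cone over a strictly convex domain is locally supported by the tangent planes of the
boundary curve, with contact along the ray through the point of tangency only. -/
theorem eventually_local_support (hγ : IsSmoothSimpleClosed γ) (hΩ : IsPositiveBoundary γ Ω)
    (hconv : IsStrictlyConvex γ) (t₀ : ℝ) :
    ∀ᶠ x in nhds (lift γ t₀), x ∈ closure (cone Ω) → 0 ≤ inner ℝ x (conormal γ t₀) ∧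
      (inner ℝ x (conormal γ t₀) = (0 : ℝ) → ∃ r : ℝ, x = r • lift γ t₀) := by
  obtain ⟨δ, hδ, hball⟩ := exists_ball_normalCoord hγ hΩ t₀
  obtain ⟨e, he⟩ := exists_hasStrictFDerivAt_normalCoord hγ t₀
  have h0 : normalCoord γ (t₀, 0, 1) = lift γ t₀ := by simp [normalCoord]
  rw [← h0, ← he.map_nhds_eq_of_equiv, Filter.eventually_map]
  have hr : ∀ᶠ z in nhds ((t₀, 0, 1) : ℝ × ℝ × ℝ), 0 < z.2.2 :=
    (continuous_snd.snd.continuousAt).eventually (lt_mem_nhds (by norm_num))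
  have hη : ∀ᶠ z in nhds ((t₀, 0, 1) : ℝ × ℝ × ℝ),
      0 < inner ℝ (conormal γ z.1) (conormal γ t₀) := by
    have hc : Continuous fun z : ℝ × ℝ × ℝ => (inner ℝ (conormal γ z.1) (conormal γ t₀) : ℝ) :=
      ((continuous_conormal hγ).comp continuous_fst).inner continuous_const
    exact hc.continuousAt.eventually (lt_mem_nhds (by simpa only [inner_conormal_conormal hγ] using one_pos))
  have hlift := (continuous_fst (X := ℝ) (Y := ℝ × ℝ)).continuousAt (x := (t₀, 0, 1))
    |>.eventually (eventually_inner_lift_conormal_pos hγ hconv t₀)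
  filter_upwards [Metric.ball_mem_nhds _ hδ, hr, hη, hlift] with z hz hr hη hlift hzcl
  have hε := hball z hz hzcl
  -- Both summands in the bracket are nonnegative near the base point; their sum vanishes only if
  -- the offset is zero and the parameter is `t₀`.
  have hval : inner ℝ (normalCoord γ z) (conormal γ t₀) = z.2.2 *
      (inner ℝ (lift γ z.1) (conormal γ t₀) + z.2.1 * inner ℝ (conormal γ z.1) (conormal γ t₀)) := by
    simp only [normalCoord, inner_smul_left, inner_add_left, conj_trivial]
  have hle : 0 ≤ inner ℝ (lift γ z.1) (conormal γ t₀) := by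
    by_cases h : z.1 = t₀
    · rw [h, inner_lift_conormal]
    · exact (hlift h).le
  rw [hval]
  refine ⟨mul_nonneg hr.le (add_nonneg hle (mul_nonneg hε hη.le)), fun h => ?_⟩
  have h1 := (mul_eq_zero.1 h).resolve_left hr.ne'
  have h2 := mul_nonneg hε hη.le
  have h3 : z.2.1 = 0 := (mul_eq_zero.1 (by linarith)).resolve_right hη.ne'
  have h4 : z.1 = t₀ := by
    by_contra hne
    linarith [hlift hne]
  exact ⟨z.2.2, by simp [normalCoord, h3, h4]⟩

/-! ### Convexity of the cone -/

theorem eventually_local_support_smul (hγ : IsSmoothSimpleClosed γ)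
    (hΩ : IsPositiveBoundary γ Ω) (hconv : IsStrictlyConvex γ) (t₀ : ℝ) {r : ℝ} (hr : 0 < r) :
    ∀ᶠ x in nhds (r • lift γ t₀), x ∈ closure (cone Ω) → 0 ≤ inner ℝ x (conormal γ t₀) ∧
      (inner ℝ x (conormal γ t₀) = (0 : ℝ) → ∃ c : ℝ, x = c • lift γ t₀) := by
  have hc : ContinuousAt (fun x : E3 => r⁻¹ • x) (r • lift γ t₀) := by fun_prop
  have h := eventually_local_support hγ hΩ hconv t₀
  have heq : lift γ t₀ = r⁻¹ • r • lift γ t₀ := by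
    rw [smul_smul, inv_mul_cancel₀ hr.ne', one_smul]
  rw [heq] at h
  filter_upwards [hc.eventually h] with x hx hxcl
  obtain ⟨h1, h2⟩ := hx (smul_mem_closure_cone hxcl (inv_pos.2 hr))
  rw [inner_smul_left, conj_trivial] at h1 h2
  refine ⟨nonneg_of_mul_nonneg_right h1 (inv_pos.2 hr), fun h3 => ?_⟩
  obtain ⟨c, hc⟩ := h2 (by rw [h3, mul_zero])
  rw [← heq] at hc
  refine ⟨r * c, ?_⟩
  rw [← smul_smul, ← hc, smul_smul, mul_inv_cancel₀ hr.ne', one_smul]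

/-- By compactness of the parameter interval. For fixed `p`, this set of points visible from `p` is
the one to be shown relatively closed in the cone. -/
theorem isOpen_setOf_segment_subset {K : Set E3} (hK : IsOpen K) (p : E3) :
    IsOpen {x | segment ℝ p x ⊆ K} := by
  have heq : {x | segment ℝ p x ⊆ K} = {x | ∀ s ∈ Set.Icc (0 : ℝ) 1, p + s • (x - p) ∈ K} := by
    ext x
    change segment ℝ p x ⊆ K ↔ _
    rw [segment_eq_image', Set.image_subset_iff]
    rfl
  rw [heq, isOpen_iff_mem_nhds]
  intro x hx
  refine isCompact_Icc.eventually_forall_of_forall_eventually fun s hs => ?_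
  have hc : ContinuousAt (fun z : E3 × ℝ => p + z.2 • (z.1 - p)) (x, s) := by fun_prop
  exact hc.eventually (hK.mem_nhds (hx s hs))

theorem segment_subset_closure {K : Set E3} {p x : E3} (hx : x ∈ closure {x | segment ℝ p x ⊆ K}) :
    segment ℝ p x ⊆ closure K := by
  rw [segment_eq_image']
  rintro _ ⟨s, hs, rfl⟩
  have hc : Continuous fun x : E3 => p + s • (x - p) := by fun_prop
  refine map_mem_closure (f := fun x : E3 => p + s • (x - p)) hc hx fun y hy => ?_
  have hy' : segment ℝ p y ⊆ K := hy
  rw [segment_eq_image'] at hy'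
  exact hy' ⟨s, hs, rfl⟩

/-- The limiting segment lies in the closed cone. If it touched the frontier at an interior point `y
= r • γ(t)`, moving both ways from `y` would stay on one side of the tangent plane, hence in it,
hence on the line through `γ(t)`. Then `p` is a multiple of `γ(t)`: a positive one is not in the
cone, a nonpositive one puts the apex on the segment. -/
theorem segment_subset_cone_of_mem_closure (hγ : IsSmoothSimpleClosed γ)
    (hΩ : IsPositiveBoundary γ Ω) (hconv : IsStrictlyConvex γ) {p x : E3} (hp : p ∈ cone Ω)
    (hx : x ∈ cone Ω) (hxcl : x ∈ closure {x | segment ℝ p x ⊆ cone Ω})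
    (h0 : (0 : E3) ∉ segment ℝ p x) : segment ℝ p x ⊆ cone Ω := by
  have hsub := segment_subset_closure hxcl
  intro y hy
  by_contra hyc
  have hy0 : y ≠ 0 := fun h => h0 (h ▸ hy)
  obtain ⟨t, r, hr, hyr⟩ := exists_smul_lift_of_mem_closure_cone hΩ (hsub hy) hyc hy0
  have hsup := eventually_local_support_smul hγ hΩ hconv t hr
  rw [← hyr] at hsup
  have hy' := hy
  rw [segment_eq_image'] at hy'
  obtain ⟨s, ⟨hs0, hs1⟩, hys⟩ := hy'
  simp only at hys
  have hs0' : 0 < s := hs0.lt_of_ne fun h => hyc (by rw [← hys, ← h]; simpa using hp)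
  have hs1' : s < 1 := hs1.lt_of_ne fun h => hyc (by rw [← hys, h]; simpa using hx)
  have hc : ContinuousAt (fun u : ℝ => y + u • (x - p)) 0 := by fun_prop
  have hev : ∀ᶠ u in nhds (0 : ℝ), 0 ≤ inner ℝ (y + u • (x - p)) (conormal γ t) ∧
      (inner ℝ (y + u • (x - p)) (conormal γ t) = (0 : ℝ) →
        ∃ c : ℝ, y + u • (x - p) = c • lift γ t) := by
    have h1 : ∀ᶠ u in nhds (0 : ℝ), s + u ∈ Set.Ioo (0 : ℝ) 1 := by
      have : ContinuousAt (fun u : ℝ => s + u) 0 := by fun_prop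
      exact this.eventually (Ioo_mem_nhds (by simpa using hs0') (by simpa using hs1'))
    have h2 : ∀ᶠ z in nhds (y + (0 : ℝ) • (x - p)), z ∈ closure (cone Ω) →
        0 ≤ inner ℝ z (conormal γ t) ∧
        (inner ℝ z (conormal γ t) = (0 : ℝ) → ∃ c : ℝ, z = c • lift γ t) := by
      simpa using hsup
    filter_upwards [h1, hc.eventually h2] with u hu1 hu2
    apply hu2
    apply hsub
    rw [segment_eq_image']
    exact ⟨s + u, ⟨hu1.1.le, hu1.2.le⟩, by simp only [← hys]; module⟩
  obtain ⟨δ, hδ, hball⟩ := Metric.eventually_nhds_iff.1 hev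
  have hyη : inner ℝ y (conormal γ t) = (0 : ℝ) := by
    rw [hyr, inner_smul_left, inner_lift_conormal, mul_zero]
  have hplus := hball (y := δ / 2) (by simp [abs_of_pos hδ]; linarith)
  have hminus := hball (y := -(δ / 2)) (by simp [abs_of_pos hδ]; linarith)
  simp only [inner_add_left, inner_smul_left, hyη, conj_trivial, zero_add] at hplus hminus
  have hw : inner ℝ (x - p) (conormal γ t) = (0 : ℝ) := by nlinarith [hplus.1, hminus.1]
  obtain ⟨c, hc⟩ := hplus.2 (by rw [hw, mul_zero])
  have hxp : x - p = ((c - r) / (δ / 2)) • lift γ t := by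
    have : (δ / 2) • (x - p) = (c - r) • lift γ t := by
      rw [sub_smul, ← hc, ← hyr]; module
    rw [div_eq_inv_mul, ← smul_smul, ← this, smul_smul, inv_mul_cancel₀ (by positivity), one_smul]
  set d := r - s * ((c - r) / (δ / 2)) with hd
  have hpd : p = d • lift γ t := by
    have : p = y - s • (x - p) := by rw [← hys]; module
    rw [this, hyr, hxp, hd]; module
  by_cases hdpos : 0 < d
  · rw [hpd, smul_mem_cone_iff hdpos] at hp
    exact lift_notMem_cone hΩ t hp
  · push Not at hdpos
    apply h0
    rw [segment_eq_image']
    have hrd : 0 < r - d := by linarith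
    have hθ : -d / (r - d) ≤ 1 := by rw [div_le_one hrd]; linarith
    have hθ0 : 0 ≤ -d / (r - d) := div_nonneg (by linarith) hrd.le
    -- The coefficient of `γ(t)` runs affinely from `d ≤ 0` at `p` to `r > 0` at parameter `s`, so
    -- it vanishes at the fraction `-d / (r - d)` of the way.
    refine ⟨-d / (r - d) * s, ⟨mul_nonneg hθ0 hs0, by nlinarith⟩, ?_⟩
    have h1 : s • (x - p) = (r - d) • lift γ t := by
      rw [hxp, hd, smul_smul]; congr 1; ring
    simp only
    rw [← smul_smul, h1, hpd, smul_smul, ← add_smul, div_mul_cancel₀ _ hrd.ne']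
    simp

theorem smul_add_smul_mem_cone {p x : E3} (h : segment ℝ p x ⊆ cone Ω) {a b : ℝ} (ha : 0 ≤ a)
    (hb : 0 ≤ b) (hab : 0 < a + b) : a • p + b • x ∈ cone Ω := by
  have h1 : (a / (a + b)) • p + (b / (a + b)) • x ∈ cone Ω :=
    h ⟨a / (a + b), b / (a + b), by positivity, by positivity, by field_simp, rfl⟩
  have h2 := smul_mem_cone h1 hab
  rwa [smul_add, smul_smul, smul_smul, mul_div_cancel₀ _ hab.ne', mul_div_cancel₀ _ hab.ne'] at h2

theorem one_lt_rank_quotient_span_singleton (p : E3) :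
    1 < Module.rank ℝ (E3 ⧸ Submodule.span ℝ {p}) := by
  rw [← Module.finrank_eq_rank]
  have h1 := Submodule.finrank_quotient_add_finrank (Submodule.span ℝ {p})
  have h2 := finrank_span_le_card (R := ℝ) ({p} : Set E3)
  simp only [Set.toFinset_singleton, Finset.card_singleton] at h2
  have h3 : Module.finrank ℝ E3 = 3 := by simp
  rw [h3] at h1
  exact_mod_cast (by omega : 1 < Module.finrank ℝ (E3 ⧸ Submodule.span ℝ {p}))

/-- A radial contraction of the whole space onto the ball preserves the line through `p`, and the
complement of a line in three dimensions is connected. -/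
theorem isPreconnected_ball_diff_span (p : E3) {δ : ℝ} (hδ : 0 < δ) :
    IsPreconnected (Metric.ball (-p) δ \ (Submodule.span ℝ {p} : Set E3)) := by
  have hpos : ∀ x : E3, 0 < 1 + ‖x‖ := fun x => by positivity
  have hcon := (isConnected_compl_of_one_lt_codim
    (one_lt_rank_quotient_span_singleton p)).isPreconnected
  have him := hcon.image (fun x : E3 => -p + (δ / (1 + ‖x‖)) • x)
    (by
      have h : Continuous fun x : E3 => δ / (1 + ‖x‖) :=
        continuous_const.div (by fun_prop) fun x => (hpos x).ne'
      exact (continuous_const.add (h.smul continuous_id')).continuousOn)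
  convert him using 1
  have hp : p ∈ Submodule.span ℝ {p} := Submodule.mem_span_singleton_self p
  ext z
  constructor
  · rintro ⟨hz, hzp⟩
    rw [mem_ball_iff_norm, sub_neg_eq_add] at hz
    have hlt : 0 < δ - ‖z + p‖ := by linarith
    refine ⟨(δ - ‖z + p‖)⁻¹ • (z + p), fun hmem => hzp ?_, ?_⟩
    · have h1 := Submodule.smul_mem _ (δ - ‖z + p‖) hmem
      rw [smul_smul, mul_inv_cancel₀ hlt.ne', one_smul] at h1
      simpa using Submodule.sub_mem _ h1 hp
    · simp only [norm_smul, norm_inv, Real.norm_of_nonneg hlt.le, smul_smul]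
      have h2 : δ / (1 + (δ - ‖z + p‖)⁻¹ * ‖z + p‖) * (δ - ‖z + p‖)⁻¹ = 1 := by
        field_simp
        ring
      rw [h2]; module
  · rintro ⟨x, hx, rfl⟩
    refine ⟨?_, fun hmem => hx ?_⟩
    · rw [mem_ball_iff_norm]
      simp only [neg_add_cancel_comm, sub_neg_eq_add]
      rw [norm_smul, Real.norm_of_nonneg (by positivity), div_mul_eq_mul_div,
        div_lt_iff₀ (hpos x)]
      nlinarith [norm_nonneg x]
    · have h1 := Submodule.add_mem _ hmem hp
      have h2 := Submodule.smul_mem _ (δ / (1 + ‖x‖))⁻¹ h1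
      have h3 : δ / (1 + ‖x‖) ≠ 0 := (div_pos hδ (hpos x)).ne'
      rwa [neg_add_cancel_comm, smul_smul, inv_mul_cancel₀ h3, one_smul] at h2

theorem exists_nonpos_smul_of_zero_mem_segment {p x : E3} (hp : p ≠ 0)
    (h : (0 : E3) ∈ segment ℝ p x) : ∃ c : ℝ, c ≤ 0 ∧ x = c • p := by
  obtain ⟨a, b, ha, hb, hab, h⟩ := h
  have hb0 : b ≠ 0 := by
    rintro rfl
    exact hp (by simpa [show a = 1 by linarith] using h)
  refine ⟨-(b⁻¹ * a), by simp only [Left.neg_nonpos_iff]; positivity, ?_⟩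
  have h1 : b • x = -(a • p) := by rw [eq_neg_iff_add_eq_zero, add_comm]; exact h
  rw [neg_smul, ← smul_smul, ← smul_neg, ← h1, smul_smul, inv_mul_cancel₀ hb0, one_smul]

theorem exists_nonpos_smul_of_mem_closure (hγ : IsSmoothSimpleClosed γ)
    (hΩ : IsPositiveBoundary γ Ω) (hconv : IsStrictlyConvex γ) {p x : E3} (hp : p ∈ cone Ω)
    (hx : x ∈ cone Ω) (hxcl : x ∈ closure {x | segment ℝ p x ⊆ cone Ω})
    (hxS : ¬ segment ℝ p x ⊆ cone Ω) : ∃ c : ℝ, c ≤ 0 ∧ x = c • p := by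
  by_contra hne
  exact hxS (segment_subset_cone_of_mem_closure hγ hΩ hconv hp hx hxcl fun h0 =>
    hne (exists_nonpos_smul_of_zero_mem_segment (ne_zero_of_mem_cone hp) h0))

theorem neg_mem_cone_of_nonpos_smul_mem {p : E3} {c : ℝ} (hc : c ≤ 0) (h : c • p ∈ cone Ω) :
    c < 0 ∧ -p ∈ cone Ω := by
  have hc' : c < 0 := hc.lt_of_ne fun h0 => ne_zero_of_mem_cone h (by rw [h0, zero_smul])
  refine ⟨hc', (smul_mem_cone_iff (neg_pos.2 hc')).1 ?_⟩
  simpa using h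

/-- Visibility from `p` can fail to be closed only on the ray opposite to `p`. Suppose `-p` is in
the cone, and remove the line of `p` from a small ball around `-p`. If some remaining point is
visible, all are, among them `-p + (δ/2) • γ(0)`; adding `p` puts `γ(0)` in the cone. If none is,
`-p` is not a limit of visible points, so visibility is closed in the cone and `-p` itself is
visible through the apex, which is absurd. -/
theorem neg_notMem_cone (hγ : IsSmoothSimpleClosed γ)
    (hΩ : IsPositiveBoundary γ Ω) (hconv : IsStrictlyConvex γ) {p : E3} (hp : p ∈ cone Ω) :
    -p ∉ cone Ω := by
  intro hnp
  have hopen := isOpen_cone hΩ.isOpen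
  set S : Set E3 := {x | segment ℝ p x ⊆ cone Ω} with hS
  have hSo : IsOpen S := isOpen_setOf_segment_subset hopen p
  have hpS : p ∈ S := by
    change segment ℝ p p ⊆ cone Ω
    simpa using hp
  have hS0 : ∀ c : ℝ, c ≤ 0 → c • p ∉ S := by
    intro c hc h
    have := smul_add_smul_mem_cone h (a := -c) (b := 1) (by linarith) (by norm_num) (by linarith)
    exact ne_zero_of_mem_cone this (by module)
  obtain ⟨δ', hδ', hball'⟩ := Metric.isOpen_iff.1 hopen _ hnp
  have hpn : 0 < ‖p‖ := norm_pos_iff.2 (ne_zero_of_mem_cone hp)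
  -- The bound by `‖p‖` keeps positive multiples of `p` out of the ball.
  set δ := min δ' ‖p‖
  have hδ : 0 < δ := lt_min hδ' hpn
  have hball : Metric.ball (-p) δ ⊆ cone Ω :=
    (Metric.ball_subset_ball (min_le_left _ _)).trans hball'
  set P : Set E3 := Metric.ball (-p) δ \ (Submodule.span ℝ {p} : Set E3) with hP
  have hPpre : IsPreconnected P := isPreconnected_ball_diff_span p hδ
  by_cases hPS : (P ∩ S).Nonempty
  · have hsub : P ⊆ S := by
      refine hPpre.subset_of_closure_inter_subset hSo hPS ?_
      rintro x ⟨hxcl, hxP⟩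
      by_contra hxS
      obtain ⟨c, _, hc⟩ :=
        exists_nonpos_smul_of_mem_closure hγ hΩ hconv hp (hball hxP.1) hxcl hxS
      exact hxP.2 (Submodule.mem_span_singleton.2 ⟨c, hc.symm⟩)
    have hy := lift_notMem_cone hΩ 0
    have hyn := norm_lift γ 0
    have hyspan : lift γ 0 ∉ Submodule.span ℝ {p} := by
      intro h
      obtain ⟨c, hc⟩ := Submodule.mem_span_singleton.1 h
      rw [← hc] at hy hyn
      rcases lt_trichotomy c 0 with h | h | h
      · exact hy (by simpa using smul_mem_cone hnp (neg_pos.2 h))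
      · rw [h, zero_smul, norm_zero] at hyn
        exact zero_ne_one hyn
      · exact hy (smul_mem_cone hp h)
    have hz : -p + (δ / 2) • lift γ 0 ∈ P := by
      refine ⟨?_, fun h => hyspan ?_⟩
      · rw [mem_ball_iff_norm, sub_neg_eq_add, neg_add_cancel_comm, norm_smul, hyn,
          Real.norm_of_nonneg (by positivity)]
        linarith
      · have h1 := Submodule.smul_mem _ (δ / 2)⁻¹
          (Submodule.add_mem _ h (Submodule.mem_span_singleton_self p))
        rwa [neg_add_cancel_comm, smul_smul, inv_mul_cancel₀ (by positivity), one_smul] at h1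
    have h1 := smul_add_smul_mem_cone (hsub hz) (a := (δ / 2)⁻¹) (b := (δ / 2)⁻¹)
      (by positivity) (by positivity) (by positivity)
    rw [← smul_add, add_neg_cancel_left, smul_smul, inv_mul_cancel₀ (by positivity),
      one_smul] at h1
    exact hy h1
  · have hsub : cone Ω ⊆ S := by
      refine (isPreconnected_cone hΩ.isConnected.isPreconnected).subset_of_closure_inter_subset
        hSo ⟨p, hp, hpS⟩ ?_
      rintro x ⟨hxcl, hxK⟩
      by_contra hxS
      obtain ⟨c, hc, rfl⟩ := exists_nonpos_smul_of_mem_closure hγ hΩ hconv hp hxK hxcl hxS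
      obtain ⟨hc', -⟩ := neg_mem_cone_of_nonpos_smul_mem hc hxK
      have hnpcl : -p ∈ closure S := by
        have h1 := map_mem_closure (continuous_const_smul (-c)⁻¹) hxcl (t := S) ?_
        · rwa [smul_smul, inv_neg, neg_mul, inv_mul_cancel₀ hc'.ne, neg_one_smul] at h1
        · rintro z hz _ ⟨a, b, ha, hb, hab, rfl⟩
          have hcpos : 0 < (-c)⁻¹ := inv_pos.2 (neg_pos.2 hc')
          rw [smul_smul]
          refine smul_add_smul_mem_cone hz ha (by positivity) ?_
          rcases hb.eq_or_lt with h | h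
          · rw [← h] at hab ⊢; linarith
          · positivity
      obtain ⟨z, hzS, hzd⟩ := Metric.mem_closure_iff.1 hnpcl δ hδ
      refine hPS ⟨z, ⟨Metric.mem_ball'.2 hzd, fun hspan => ?_⟩, hzS⟩
      obtain ⟨b, rfl⟩ := Submodule.mem_span_singleton.1 hspan
      rcases le_or_gt b 0 with hb | hb
      · exact hS0 b hb hzS
      · rw [dist_eq_norm, show -p - b • p = -((1 + b) • p) by module, norm_neg, norm_smul,
          Real.norm_of_nonneg (by positivity)] at hzd
        have : δ ≤ ‖p‖ := min_le_right _ _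
        nlinarith
    have := hsub hnp
    exact hS0 (-1) (by norm_num) (by simpa using this)

theorem convex_cone (hγ : IsSmoothSimpleClosed γ)
    (hΩ : IsPositiveBoundary γ Ω) (hconv : IsStrictlyConvex γ) : Convex ℝ (cone Ω) := by
  rw [convex_iff_segment_subset]
  intro p hp x hx
  have hsub : cone Ω ⊆ {x | segment ℝ p x ⊆ cone Ω} := by
    refine (isPreconnected_cone hΩ.isConnected.isPreconnected).subset_of_closure_inter_subset
      (isOpen_setOf_segment_subset (isOpen_cone hΩ.isOpen) p) ⟨p, hp, ?_⟩ ?_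
    · change segment ℝ p p ⊆ cone Ω
      simpa using hp
    · rintro x ⟨hxcl, hxK⟩
      by_contra hxS
      obtain ⟨c, hc, rfl⟩ := exists_nonpos_smul_of_mem_closure hγ hΩ hconv hp hxK hxcl hxS
      exact neg_notMem_cone hγ hΩ hconv hp (neg_mem_cone_of_nonpos_smul_mem hc hxK).2
  exact hsub hx

/-! ### Global support and the tangent half-planes -/

/-- Local support becomes global by convexity: `γ(t) + u • x` stays in the closed cone and is near
`γ(t)` for small `u > 0`, and its product with `η(t)` is `u⟨x, η(t)⟩`. -/
theorem inner_conormal_nonneg (hγ : IsSmoothSimpleClosed γ) (hΩ : IsPositiveBoundary γ Ω)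
    (hconv : IsStrictlyConvex γ) {x : E3} (hx : x ∈ closure (cone Ω)) (t : ℝ) :
    0 ≤ inner ℝ x (conormal γ t) ∧
      (inner ℝ x (conormal γ t) = (0 : ℝ) → ∃ c : ℝ, x = c • lift γ t) := by
  have hcl : Convex ℝ (closure (cone Ω)) := (convex_cone hγ hΩ hconv).closure
  have hsum : ∀ u : ℝ, 0 < u → lift γ t + u • x ∈ closure (cone Ω) := by
    intro u hu
    have h1 := hcl (lift_mem_closure_cone hΩ t) (smul_mem_closure_cone hx hu)
      (a := 1 / 2) (b := 1 / 2) (by norm_num) (by norm_num) (by norm_num)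
    have h2 := smul_mem_closure_cone h1 (c := 2) (by norm_num)
    rwa [show (2 : ℝ) • ((1 / 2 : ℝ) • lift γ t + (1 / 2 : ℝ) • u • x) = lift γ t + u • x by
      module] at h2
  have hc : ContinuousAt (fun u : ℝ => lift γ t + u • x) 0 := by fun_prop
  have hev := eventually_local_support hγ hΩ hconv t
  rw [show lift γ t = lift γ t + (0 : ℝ) • x by simp] at hev
  have hev' := (hc.eventually hev).filter_mono (nhdsWithin_le_nhds (s := Set.Ioi 0))
  obtain ⟨u, hu, hupos⟩ := (hev'.and self_mem_nhdsWithin).exists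
  have hupos' : 0 < u := hupos
  obtain ⟨h1, h2⟩ := hu (hsum u hupos')
  simp only [inner_add_left, inner_smul_left, inner_lift_conormal, conj_trivial, zero_add,
    zero_smul, add_zero] at h1 h2
  refine ⟨nonneg_of_mul_nonneg_right h1 hupos', fun h => ?_⟩
  obtain ⟨c, hc⟩ := h2 (by rw [h, mul_zero])
  refine ⟨u⁻¹ * (c - 1), ?_⟩
  have : u • x = (c - 1) • lift γ t := by rw [sub_smul, ← hc]; module
  rw [← smul_smul, ← this, smul_smul, inv_mul_cancel₀ hupos'.ne', one_smul]

theorem neg_lift_notMem_cone (hγ : IsSmoothSimpleClosed γ) (hΩ : IsPositiveBoundary γ Ω)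
    (hconv : IsStrictlyConvex γ) (t : ℝ) : -lift γ t ∉ cone Ω := by
  intro h
  have hn : {z : E3 | -z ∈ cone Ω} ∈ nhds (lift γ t) :=
    (continuous_neg.isOpen_preimage _ (isOpen_cone hΩ.isOpen)).mem_nhds h
  obtain ⟨z, hz1, hz2⟩ := mem_closure_iff_nhds.1 (lift_mem_closure_cone hΩ t) _ hn
  exact neg_notMem_cone hγ hΩ hconv hz2 hz1

theorem inner_conormal_pos (hγ : IsSmoothSimpleClosed γ) (hΩ : IsPositiveBoundary γ Ω)
    (hconv : IsStrictlyConvex γ) {x : E3} (hx : x ∈ cone Ω) (t : ℝ) :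
    0 < inner ℝ x (conormal γ t) := by
  obtain ⟨h1, h2⟩ := inner_conormal_nonneg hγ hΩ hconv (subset_closure hx) t
  refine h1.lt_of_ne fun h => ?_
  obtain ⟨c, rfl⟩ := h2 h.symm
  rcases le_or_gt c 0 with hc | hc
  · exact neg_lift_notMem_cone hγ hΩ hconv t (neg_mem_cone_of_nonpos_smul_mem hc hx).2
  · exact lift_notMem_cone hΩ t ((smul_mem_cone_iff hc).1 hx)

/-- The cone over a strictly convex domain is the intersection of the open half-spaces bounded by
the tangent planes. -/
theorem mem_cone_iff_inner_conormal_pos (hγ : IsSmoothSimpleClosed γ)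
    (hΩ : IsPositiveBoundary γ Ω) (hconv : IsStrictlyConvex γ) {x : E3} :
    x ∈ cone Ω ↔ ∀ t, 0 < inner ℝ x (conormal γ t) := by
  refine ⟨fun hx t => inner_conormal_pos hγ hΩ hconv hx t, fun hx => ?_⟩
  obtain ⟨y, hy⟩ := hΩ.isConnected.nonempty
  have hp : (y : E3) ∈ cone Ω := (coe_mem_cone_iff y).2 hy
  -- The segment keeps strictly to the positive side of every tangent plane, whereas each frontier
  -- point of the cone is on one of them; so it cannot leave.
  have hsub : segment ℝ (y : E3) x ⊆ cone Ω := by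
    refine (convex_segment _ _).isPreconnected.subset_of_closure_inter_subset
      (isOpen_cone hΩ.isOpen) ⟨_, left_mem_segment ℝ _ _, hp⟩ ?_
    rintro z ⟨hzcl, a, b, ha, hb, hab, rfl⟩
    have hpos : ∀ t, 0 < inner ℝ (a • (y : E3) + b • x) (conormal γ t) := by
      intro t
      simp only [inner_add_left, inner_smul_left, conj_trivial]
      have h1 := inner_conormal_pos hγ hΩ hconv hp t
      have h2 := hx t
      rcases ha.eq_or_lt with h | h
      · rw [← h] at hab ⊢
        have : b = 1 := by linarith
        rw [this]; linarith
      · have := mul_pos h h1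
        have := mul_nonneg hb h2.le
        linarith
    by_contra hzc
    have hz0 : a • (y : E3) + b • x ≠ 0 := by
      intro h
      have := hpos 0
      rw [h, inner_zero_left] at this
      exact lt_irrefl _ this
    obtain ⟨t, r, hr, hzr⟩ := exists_smul_lift_of_mem_closure_cone hΩ hzcl hzc hz0
    have := hpos t
    rw [hzr, inner_smul_left, inner_lift_conormal, mul_zero] at this
    exact lt_irrefl _ this
  exact hsub (right_mem_segment ℝ _ _)

theorem smul_lift_norm {t s c : ℝ} (h : lift γ t = c • lift γ s) : c = 1 ∨ c = -1 := by
  have h1 := congrArg norm h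
  rw [norm_smul, norm_lift, norm_lift, mul_one, Real.norm_eq_abs] at h1
  exact eq_or_eq_neg_of_abs_eq h1.symm

theorem exp_eq_of_lift_eq (hγ : IsSmoothSimpleClosed γ) {t s : ℝ} (h : lift γ t = lift γ s) :
    Circle.exp t = Circle.exp s :=
  hγ.simple (Subtype.ext h)

theorem eq_of_lift_eq (hγ : IsSmoothSimpleClosed γ) {t s : ℝ} (h : lift γ t = lift γ s)
    (ht : t ∈ Set.Ico 0 (2 * Real.pi)) (hs : s ∈ Set.Ico 0 (2 * Real.pi)) : t = s :=
  Circle.exp_injOn_Ico (by simp) ht hs (exp_eq_of_lift_eq hγ h)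

/-- If `±γ(s)` both lie on the curve, support from both gives `⟨γ(s), η(u)⟩ = 0` for all `u`, so
every `γ(u)` is one of these two points. The parameters `0, 1, 2` already give three. -/
theorem lift_ne_neg_lift (hγ : IsSmoothSimpleClosed γ) (hΩ : IsPositiveBoundary γ Ω)
    (hconv : IsStrictlyConvex γ) (t s : ℝ) : lift γ t ≠ -lift γ s := by
  intro hts
  have hpm : ∀ u, lift γ u = lift γ s ∨ lift γ u = -lift γ s := by
    intro u
    obtain ⟨h1, h2⟩ := inner_conormal_nonneg hγ hΩ hconv (lift_mem_closure_cone hΩ s) u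
    have h3 := (inner_conormal_nonneg hγ hΩ hconv (lift_mem_closure_cone hΩ t) u).1
    rw [hts, inner_neg_left] at h3
    obtain ⟨c, hc⟩ := h2 (by linarith)
    rcases smul_lift_norm hc with h | h
    · left; rw [hc, h, one_smul]
    · right; rw [hc, h]; simp
  have hpi := Real.pi_gt_three
  have h01 : lift γ 0 ≠ lift γ 1 := fun h =>
    zero_ne_one (eq_of_lift_eq hγ h ⟨le_rfl, by linarith⟩ ⟨by norm_num, by linarith⟩)
  have h02 : lift γ 0 ≠ lift γ 2 := fun h =>
    two_ne_zero (eq_of_lift_eq hγ h ⟨le_rfl, by linarith⟩ ⟨by norm_num, by linarith⟩).symm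
  have h12 : lift γ 1 ≠ lift γ 2 := fun h => by
    have := eq_of_lift_eq hγ h ⟨by norm_num, by linarith⟩ ⟨by norm_num, by linarith⟩
    norm_num at this
  rcases hpm 0 with h0 | h0 <;> rcases hpm 1 with h1 | h1 <;> rcases hpm 2 with h2 | h2 <;>
    first
    | exact h01 (h0.trans h1.symm)
    | exact h02 (h0.trans h2.symm)
    | exact h12 (h1.trans h2.symm)

/-- The parametrisation of the region swept out by the half-planes tangent to the cone. -/
def tangentMap (γ : Circle → S2) (t a b : ℝ) : E3 := a • lift γ t + b • tangent γ t

theorem inner_tangentMap_conormal (γ : Circle → S2) (t a b : ℝ) :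
    inner ℝ (tangentMap γ t a b) (conormal γ t) = (0 : ℝ) := by
  simp [tangentMap, inner_add_left, inner_smul_left, inner_lift_conormal, inner_tangent_conormal]

theorem inner_tangentMap_lift (hγ : IsSmoothSimpleClosed γ) (t a b : ℝ) :
    inner ℝ (tangentMap γ t a b) (lift γ t) = a := by
  rw [tangentMap, inner_add_left, inner_smul_left, inner_smul_left, inner_lift_lift,
    real_inner_comm, inner_lift_tangent hγ]
  simp

theorem inner_tangentMap_tangent (hγ : IsSmoothSimpleClosed γ) (t a b : ℝ) :
    inner ℝ (tangentMap γ t a b) (tangent γ t) = b := by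
  rw [tangentMap, inner_add_left, inner_smul_left, inner_smul_left, inner_tangent_tangent hγ,
    inner_lift_tangent hγ]
  simp

theorem inner_cross_tangentMap (γ : Circle → S2) (x : E3) (t a b : ℝ) :
    inner ℝ x (cross (lift γ t) (tangentMap γ t a b)) = b * inner ℝ x (conormal γ t) := by
  rw [tangentMap, conormal, ← crossCLM_apply, map_add, map_smul, map_smul, crossCLM_apply,
    crossCLM_apply, cross_self, smul_zero, zero_add, inner_smul_right]

theorem norm_sq_tangentMap (hγ : IsSmoothSimpleClosed γ) (t a b : ℝ) :
    ‖tangentMap γ t a b‖ ^ 2 = a ^ 2 + b ^ 2 := by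
  rw [← real_inner_self_eq_norm_sq]
  nth_rewrite 2 [tangentMap]
  rw [inner_add_right, inner_smul_right, inner_smul_right, inner_tangentMap_lift hγ,
    inner_tangentMap_tangent hγ]
  ring

/-- The triple product of `γ(t)`, `γ(t')` and the common point, evaluated in two ways, gives
`b⟨γ(t'), η(t)⟩ = -b'⟨γ(t), η(t')⟩`. Both products are nonnegative, so they vanish, and strict
support leaves only `γ(t') = ±γ(t)`. -/
theorem tangentMap_injective (hγ : IsSmoothSimpleClosed γ) (hΩ : IsPositiveBoundary γ Ω)
    (hconv : IsStrictlyConvex γ) {t a b t' a' b' : ℝ} (hb : 0 < b) (hb' : 0 < b')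
    (ht : t ∈ Set.Ico 0 (2 * Real.pi)) (ht' : t' ∈ Set.Ico 0 (2 * Real.pi))
    (h : tangentMap γ t a b = tangentMap γ t' a' b') : t = t' ∧ a = a' ∧ b = b' := by
  have h1 := inner_cross_tangentMap γ (lift γ t') t a b
  have h2 := inner_cross_tangentMap γ (lift γ t) t' a' b'
  rw [← h, inner_cross_cyclic, inner_cross_swap, h1] at h2
  obtain ⟨h3, h4⟩ := inner_conormal_nonneg hγ hΩ hconv (lift_mem_closure_cone hΩ t') t
  obtain ⟨h5, -⟩ := inner_conormal_nonneg hγ hΩ hconv (lift_mem_closure_cone hΩ t) t'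
  have h6 : inner ℝ (lift γ t') (conormal γ t) = (0 : ℝ) := by
    have := mul_nonneg hb.le h3
    have := mul_nonneg hb'.le h5
    exact (mul_eq_zero.1 (by linarith : b * inner ℝ (lift γ t') (conormal γ t) = 0)).resolve_left
      hb.ne'
  obtain ⟨c, hc⟩ := h4 h6
  have heq : t = t' := by
    rcases smul_lift_norm hc with h7 | h7
    · rw [h7, one_smul] at hc
      exact (eq_of_lift_eq hγ hc ht' ht).symm
    · rw [h7, neg_one_smul] at hc
      exact absurd hc (lift_ne_neg_lift hγ hΩ hconv _ _)
  subst heq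
  exact ⟨rfl, by rw [← inner_tangentMap_lift hγ t a b, h, inner_tangentMap_lift hγ],
    by rw [← inner_tangentMap_tangent hγ t a b, h, inner_tangentMap_tangent hγ]⟩

theorem zero_mem_closure_cone (hΩ : IsPositiveBoundary γ Ω) : (0 : E3) ∈ closure (cone Ω) := by
  obtain ⟨y, hy⟩ := hΩ.isConnected.nonempty
  have hc : ContinuousWithinAt (fun r : ℝ => r • (y : E3)) (Set.Ioi 0) 0 := by
    fun_prop
  have h := hc.mem_closure (by simp) (t := cone Ω)
    (fun r hr => smul_mem_cone ((coe_mem_cone_iff y).2 hy) hr)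
  simpa using h

/-- The required `t` is a zero of the periodic function `h = ⟨x, η⟩` at which `h` decreases. If
every zero were a strict upcrossing, periodicity would leave no zero at all, and `x` or `-x` would
be in the cone. -/
theorem exists_tangentMap_eq (hγ : IsSmoothSimpleClosed γ) (hΩ : IsPositiveBoundary γ Ω)
    (hconv : IsStrictlyConvex γ) {x : E3} (hx : x ∉ closure (cone Ω))
    (hx' : -x ∉ closure (cone Ω)) :
    ∃ t ∈ Set.Ico 0 (2 * Real.pi), ∃ a b : ℝ, 0 < b ∧ tangentMap γ t a b = x := by
  set h : ℝ → ℝ := fun t => inner ℝ x (conormal γ t) with hh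
  set h' : ℝ → ℝ := fun t => -(speed γ t * geodesicCurvature γ t) * inner ℝ x (tangent γ t) with hh'
  have hder : ∀ t, HasDerivAt h (h' t) t := by
    intro t
    refine ((hasDerivAt_const t x).inner ℝ (hasDerivAt_conormal hγ t)).congr_deriv ?_
    simp [hh', inner_smul_right]
  have hvk : ∀ t, 0 < speed γ t * geodesicCurvature γ t := fun t =>
    mul_pos (speed_pos hγ t) (hconv t)
  have hcont : Continuous h := continuous_const.inner (continuous_conormal hγ)
  have hper : Function.Periodic h (2 * Real.pi) := fun t => by
    simp [hh, conormal_periodic γ t]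
  have hexp : ∀ t, h t = 0 → x = tangentMap γ t (inner ℝ x (lift γ t)) (inner ℝ x (tangent γ t)) := by
    intro t ht
    have h1 := frame_expansion hγ t x
    have h2 : inner ℝ x (conormal γ t) = (0 : ℝ) := ht
    rw [h2, zero_smul, add_zero] at h1
    exact h1
  have hne : ∀ t, h t = 0 → inner ℝ x (tangent γ t) ≠ (0 : ℝ) := by
    intro t ht h0
    have h1 := hexp t ht
    rw [h0, tangentMap, zero_smul, add_zero] at h1
    set c : ℝ := inner ℝ x (lift γ t) with hc
    rcases lt_trichotomy c 0 with h2 | h2 | h2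
    · apply hx'
      rw [h1, ← neg_smul]
      exact smul_mem_closure_cone (lift_mem_closure_cone hΩ t) (by linarith)
    · apply hx
      rw [h1, h2, zero_smul]
      exact zero_mem_closure_cone hΩ
    · apply hx
      rw [h1]
      exact smul_mem_closure_cone (lift_mem_closure_cone hΩ t) h2
  suffices hsuff : ∃ t, h t = 0 ∧ 0 < inner ℝ x (tangent γ t) by
    obtain ⟨t, ht0, htpos⟩ := hsuff
    obtain ⟨s, hs, hst⟩ := (show Function.Periodic (fun t => (h t, (inner ℝ x (tangent γ t) : ℝ)))
      (2 * Real.pi) from fun t => by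
        simp [hper t, tangent_periodic γ t]).exists_mem_Ico₀ Real.two_pi_pos t
    simp only [Prod.mk.injEq] at hst
    exact ⟨s, hs, _, _, hst.2 ▸ htpos, (hexp s (hst.1 ▸ ht0)).symm⟩
  by_contra hno
  push Not at hno
  have hpos : ∀ t, h t = 0 → 0 < h' t := by
    intro t ht
    have h1 := (hno t ht).lt_of_ne (hne t ht)
    have h2 := hvk t
    simp only [hh']
    nlinarith
  have hex : ∃ t, 0 ≤ h t := by
    by_contra! hall
    refine hx' (subset_closure ((mem_cone_iff_inner_conormal_pos hγ hΩ hconv).2 fun t => ?_))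
    rw [inner_neg_left]
    have := hall t
    simp only [hh] at this
    linarith
  obtain ⟨t₁, ht₁⟩ := hex
  -- Since `h` increases at its zeros, it cannot become negative again; periodicity carries this
  -- back to all `t`, and a zero would then be a minimum with positive derivative.
  have hfence : ∀ t, t₁ ≤ t → 0 ≤ h t := by
    intro t ht
    have := image_le_of_deriv_right_lt_deriv_boundary' (f := fun t => -h t) (f' := fun t => -h' t)
      (a := t₁) (b := t) (B := fun _ => 0) (B' := fun _ => 0) hcont.neg.continuousOn
      (fun s _ => (hder s).neg.hasDerivWithinAt) (by simpa using ht₁) continuousOn_const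
      (fun s _ => hasDerivWithinAt_const _ _ _)
      (fun s _ hs => by have := hpos s (by simpa using hs); simpa using this)
      ⟨ht, le_rfl⟩
    simpa using this
  have hnonneg : ∀ t, 0 ≤ h t := by
    intro t
    obtain ⟨s, hs, hst⟩ := hper.exists_mem_Ico Real.two_pi_pos t t₁
    rw [hst]
    exact hfence s hs.1
  refine hx (subset_closure ((mem_cone_iff_inner_conormal_pos hγ hΩ hconv).2 fun t => ?_))
  refine (hnonneg t).lt_of_ne fun h0 => ?_
  have hmin : IsLocalMin h t := Filter.Eventually.of_forall fun s => h0 ▸ hnonneg s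
  exact (hpos t h0.symm).ne' (hmin.hasDerivAt_eq_zero (hder t))

/-! ### The Gauss–Bonnet formula -/

/-- The determinant of an endomorphism of Euclidean space is the triple product of the images of
the standard basis vectors. -/
theorem det_eq_inner_cross (A : E3 →L[ℝ] E3) :
    A.det = inner ℝ (A (EuclideanSpace.single 0 1))
      (cross (A (EuclideanSpace.single 1 1)) (A (EuclideanSpace.single 2 1))) := by
  rw [ContinuousLinearMap.det,
    ← LinearMap.det_toMatrix (EuclideanSpace.basisFun (Fin 3) ℝ).toBasis, Matrix.det_fin_three,
    inner_eq_sum]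
  simp only [LinearMap.toMatrix_apply, OrthonormalBasis.coe_toBasis,
    EuclideanSpace.basisFun_apply, OrthonormalBasis.coe_toBasis_repr_apply,
    EuclideanSpace.basisFun_repr, ContinuousLinearMap.coe_coe, cross_apply_zero, cross_apply_one,
    cross_apply_two]
  ring

/-- `tangentMap` as a self-map of Euclidean space. -/
def tangentMapE (γ : Circle → S2) (z : E3) : E3 := tangentMap γ (z 0) (z 1) (z 2)

theorem differentiable_tangentMapE (hγ : IsSmoothSimpleClosed γ) :
    Differentiable ℝ (tangentMapE γ) := by
  have h1 := (contDiff_lift hγ).differentiable (by simp)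
  have h2 := (contDiff_tangent hγ).differentiable (by simp)
  unfold tangentMapE tangentMap
  fun_prop

theorem fderiv_tangentMapE (hγ : IsSmoothSimpleClosed γ) (z w : E3) :
    fderiv ℝ (tangentMapE γ) z w = (w 0 * speed γ (z 0)) • (z 1 • tangent γ (z 0)
      + z 2 • (-lift γ (z 0) + geodesicCurvature γ (z 0) • conormal γ (z 0)))
      + w 1 • lift γ (z 0) + w 2 • tangent γ (z 0) := by
  have hline : HasDerivAt (fun u : ℝ => z + u • w) w 0 := by
    simpa using ((hasDerivAt_id (0 : ℝ)).smul_const w).const_add z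
  have h1 := (differentiable_tangentMapE hγ z).hasFDerivAt.comp_hasDerivAt_of_eq (0 : ℝ) hline
    (by simp)
  have hi : ∀ i, HasDerivAt (fun u : ℝ => z i + u * w i) (w i) 0 := fun i => by
    simpa using ((hasDerivAt_id (0 : ℝ)).mul_const (w i)).const_add (z i)
  have hL := (hasDerivAt_lift hγ (z 0)).scomp_of_eq (0 : ℝ) (hi 0) (by simp)
  have hT := (hasDerivAt_tangent hγ (z 0)).scomp_of_eq (0 : ℝ) (hi 0) (by simp)
  have h2 := ((hi 1).smul hL).add ((hi 2).smul hT)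
  have h3 : (tangentMapE γ ∘ fun u : ℝ => z + u • w) = ((fun u : ℝ => z 1 + u * w 1) •
      (lift γ ∘ fun u : ℝ => z 0 + u * w 0)) + ((fun u : ℝ => z 2 + u * w 2) •
      (tangent γ ∘ fun u : ℝ => z 0 + u * w 0)) := by
    funext u
    simp [tangentMapE, tangentMap]
  rw [h3] at h1
  rw [h1.unique h2]
  simp
  module

/-- The last two columns are `γ` and `γ_s`, with cross product `η`, so only the `η`-component of the
`t`-derivative counts. -/
theorem det_fderiv_tangentMapE (hγ : IsSmoothSimpleClosed γ) (z : E3) :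
    (fderiv ℝ (tangentMapE γ) z).det = speed γ (z 0) * geodesicCurvature γ (z 0) * z 2 := by
  rw [det_eq_inner_cross]
  simp only [fderiv_tangentMapE hγ, PiLp.single_apply]
  simp only [↓reduceIte, one_mul, zero_mul, zero_smul, one_smul, add_zero, zero_add, Fin.isValue,
    Fin.reduceEq]
  change inner ℝ _ (conormal γ (z 0)) = _
  simp only [inner_smul_left, inner_add_left, inner_neg_left, conj_trivial,
    inner_tangent_conormal, inner_lift_conormal, inner_conormal_conormal hγ]
  ring

theorem lintegral_Ioo_ofReal {R : ℝ} (hR : 0 ≤ R) :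
    ∫⁻ b in Set.Ioo 0 R, ENNReal.ofReal b = ENNReal.ofReal (R ^ 2 / 2) := by
  rw [← ofReal_integral_eq_lintegral_ofReal]
  · rw [← integral_Ioc_eq_integral_Ioo, ← intervalIntegral.integral_of_le hR, integral_id]
    congr 1; ring
  · exact (continuous_id.integrableOn_Icc (a := 0) (b := R)).mono_set Set.Ioo_subset_Icc_self
  · exact (ae_restrict_mem measurableSet_Ioo).mono fun b hb => hb.1.le

/-- The upper half of the unit disc. -/
def halfDisc : Set (ℝ × ℝ) := {w | 0 < w.2 ∧ w.1 ^ 2 + w.2 ^ 2 < 1}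

theorem measurableSet_halfDisc : MeasurableSet halfDisc := by
  refine IsOpen.measurableSet ?_
  exact (isOpen_lt continuous_const continuous_snd).inter
    (isOpen_lt (f := fun w : ℝ × ℝ => w.1 ^ 2 + w.2 ^ 2) (by fun_prop) continuous_const)

theorem lintegral_halfDisc : ∫⁻ w in halfDisc, ENNReal.ofReal w.2 = ENNReal.ofReal (2 / 3) := by
  rw [← lintegral_indicator measurableSet_halfDisc, Measure.volume_eq_prod, lintegral_prod]
  swap
  · exact ((by fun_prop : Measurable fun w : ℝ × ℝ => ENNReal.ofReal w.2).indicator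
      measurableSet_halfDisc).aemeasurable
  have hslice : ∀ a : ℝ, ∫⁻ b, halfDisc.indicator (fun w => ENNReal.ofReal w.2) (a, b)
      = ENNReal.ofReal (√(1 - a ^ 2) ^ 2 / 2) := by
    intro a
    rw [← lintegral_Ioo_ofReal (Real.sqrt_nonneg _), ← lintegral_indicator measurableSet_Ioo]
    congr 1
    funext b
    simp only [Set.indicator]
    congr 1
    simp only [halfDisc, Set.mem_Ioo, eq_iff_iff]
    refine and_congr_right fun hb : 0 < b => ?_
    rw [Real.lt_sqrt hb.le]
    change a ^ 2 + b ^ 2 < 1 ↔ _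
    constructor <;> intro h <;> linarith
  simp only [hslice]
  -- For `|a| > 1` the slice is empty, in agreement with the value `0` of the square root of a
  -- negative number.
  have hind : ∀ a : ℝ, ENNReal.ofReal (√(1 - a ^ 2) ^ 2 / 2)
      = (Set.Ioc (-1 : ℝ) 1).indicator (fun a => ENNReal.ofReal ((1 - a ^ 2) / 2)) a := by
    intro a
    by_cases ha : a ∈ Set.Ioc (-1 : ℝ) 1
    · rw [Set.indicator_of_mem ha, Real.sq_sqrt (by nlinarith [ha.1, ha.2])]
    · rw [Set.indicator_of_notMem ha, Real.sqrt_eq_zero_of_nonpos]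
      · simp
      · simp only [Set.mem_Ioc, not_and_or, not_lt, not_le] at ha
        rcases ha with h | h <;> nlinarith
  simp only [hind]
  rw [lintegral_indicator measurableSet_Ioc, ← ofReal_integral_eq_lintegral_ofReal]
  · rw [← intervalIntegral.integral_of_le (by norm_num)]
    congr 1
    rw [intervalIntegral.integral_div, intervalIntegral.integral_sub (by simp) (by simp),
      integral_pow]
    norm_num
  · have hc : Continuous fun a : ℝ => (1 - a ^ 2) / 2 := by fun_prop
    exact (hc.integrableOn_Icc (a := -1) (b := 1)).mono_set Set.Ioc_subset_Icc_self
  · exact (ae_restrict_mem measurableSet_Ioc).mono fun a ha => by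
      simp only [Pi.zero_apply]; nlinarith [ha.1, ha.2]

/-- The Jacobian is that of an endomorphism of `E3`, while Fubini needs a product; this passes
between the two. -/
theorem measurePreserving_coords :
    MeasurePreserving (fun z : E3 => ((z 0, z 1, z 2) : ℝ × ℝ × ℝ)) := by
  have h1 := PiLp.volume_preserving_ofLp (Fin 3)
  have h2 := volume_preserving_piFinSuccAbove (fun _ : Fin 3 => ℝ) 0
  have h3 := (MeasurePreserving.id (volume : Measure ℝ)).prod (volume_preserving_finTwoArrow ℝ)
  exact h3.comp (h2.comp h1)

/-- The parameter domain of the tangent half-discs. -/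
def tangentDomain : Set E3 :=
  {z | z 0 ∈ Set.Ico 0 (2 * Real.pi) ∧ 0 < z 2 ∧ z 1 ^ 2 + z 2 ^ 2 < 1}

theorem tangentDomain_eq_preimage : tangentDomain =
    (fun z : E3 => ((z 0, z 1, z 2) : ℝ × ℝ × ℝ)) ⁻¹'
      (Set.Ico 0 (2 * Real.pi) ×ˢ halfDisc) := rfl

theorem arcIntegral_geodesicCurvature_nonneg (hγ : IsSmoothSimpleClosed γ)
    (hconv : IsStrictlyConvex γ) : 0 ≤ arcIntegral γ (geodesicCurvature γ) :=
  intervalIntegral.integral_nonneg Real.two_pi_pos.le fun t _ =>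
    mul_nonneg (hconv t).le (speed_pos hγ t).le

theorem volume_image_tangentMapE (hγ : IsSmoothSimpleClosed γ) (hΩ : IsPositiveBoundary γ Ω)
    (hconv : IsStrictlyConvex γ) : volume (tangentMapE γ '' tangentDomain) =
      ENNReal.ofReal (2 / 3 * arcIntegral γ (geodesicCurvature γ)) := by
  have hmeas : MeasurableSet (Set.Ico 0 (2 * Real.pi) ×ˢ halfDisc) :=
    measurableSet_Ico.prod measurableSet_halfDisc
  have hD : MeasurableSet tangentDomain := by
    rw [tangentDomain_eq_preimage]
    exact measurePreserving_coords.measurable hmeas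
  have hinj : Set.InjOn (tangentMapE γ) tangentDomain := by
    intro z hz w hw h
    obtain ⟨h0, h1, h2⟩ := tangentMap_injective hγ hΩ hconv hz.2.1 hw.2.1 hz.1 hw.1 h
    ext i
    fin_cases i
    exacts [h0, h1, h2]
  have hk := continuous_geodesicCurvature hγ
  have hv := continuous_speed hγ
  rw [← lintegral_abs_det_fderiv_eq_addHaar_image volume hD
    (fun z _ => (differentiable_tangentMapE hγ z).hasFDerivAt.hasFDerivWithinAt) hinj]
  have hint : ∀ z ∈ tangentDomain, ENNReal.ofReal |(fderiv ℝ (tangentMapE γ) z).det| =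
      (fun w : ℝ × ℝ × ℝ => ENNReal.ofReal (geodesicCurvature γ w.1 * speed γ w.1) *
        ENNReal.ofReal w.2.2) (z 0, z 1, z 2) := by
    intro z hz
    have h1 := mul_pos (hconv (z 0)) (speed_pos hγ (z 0))
    have h2 := hz.2.1
    rw [det_fderiv_tangentMapE hγ, mul_comm (speed γ _), abs_of_pos (mul_pos h1 h2),
      ENNReal.ofReal_mul h1.le]
  rw [setLIntegral_congr_fun hD hint, tangentDomain_eq_preimage,
    measurePreserving_coords.setLIntegral_comp_preimage hmeas
      (f := fun w : ℝ × ℝ × ℝ => ENNReal.ofReal (geodesicCurvature γ w.1 * speed γ w.1) *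
        ENNReal.ofReal w.2.2) (by fun_prop),
    Measure.volume_eq_prod, ← Measure.prod_restrict]
  rw [lintegral_prod_mul (f := fun t => ENNReal.ofReal (geodesicCurvature γ t * speed γ t))
    (g := fun w : ℝ × ℝ => ENNReal.ofReal w.2) (by fun_prop) (by fun_prop),
    lintegral_halfDisc, ← ofReal_integral_eq_lintegral_ofReal,
    integral_Ico_eq_integral_Ioo, ← integral_Ioc_eq_integral_Ioo,
    ← intervalIntegral.integral_of_le Real.two_pi_pos.le]
  · change ENNReal.ofReal (arcIntegral γ (geodesicCurvature γ)) * _ = _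
    rw [← ENNReal.ofReal_mul (arcIntegral_geodesicCurvature_nonneg hγ hconv), mul_comm]
  · exact ((hk.mul hv).integrableOn_Icc (a := 0) (b := 2 * Real.pi)).mono_set
      Set.Ico_subset_Icc_self
  · exact Filter.Eventually.of_forall fun t => (mul_pos (hconv t) (speed_pos hγ t)).le

theorem Ioo_smul_image_eq : Set.Ioo (0 : ℝ) 1 • (Subtype.val '' Ω : Set E3) =
    cone Ω ∩ Metric.ball 0 1 := by
  ext x
  constructor
  · intro hx
    obtain ⟨r, hr, _, ⟨y, hy, rfl⟩, rfl⟩ := Set.mem_smul.1 hx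
    refine ⟨⟨y, hy, r, hr.1, rfl⟩, ?_⟩
    rw [mem_ball_zero_iff, norm_smul, norm_coe, Real.norm_of_nonneg hr.1.le, mul_one]
    exact hr.2
  · rintro ⟨⟨y, hy, r, hr, rfl⟩, hx⟩
    rw [mem_ball_zero_iff, norm_smul, norm_coe, Real.norm_of_nonneg hr.le, mul_one] at hx
    exact Set.smul_mem_smul ⟨hr, hx⟩ (Set.mem_image_of_mem _ hy)

theorem area_eq (hΩ : IsOpen Ω) : area Ω =
    3 * (volume : Measure E3).real (cone Ω ∩ Metric.ball 0 1) := by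
  rw [area, measureReal_def, Measure.toSphere_apply' _ hΩ.measurableSet, Ioo_smul_image_eq]
  simp [measureReal_def]

/-- **Gauss–Bonnet** for a strictly convex domain of the sphere. -/
theorem area_eq_two_pi_sub (hγ : IsSmoothSimpleClosed γ) (hΩ : IsPositiveBoundary γ Ω)
    (hconv : IsStrictlyConvex γ) :
    area Ω = 2 * Real.pi - arcIntegral γ (geodesicCurvature γ) := by
  set B : Set E3 := Metric.ball 0 1 with hB
  set K := cone Ω with hK
  have hKo : IsOpen K := isOpen_cone hΩ.isOpen
  have hKm : MeasurableSet (K ∩ B) := (hKo.inter Metric.isOpen_ball).measurableSet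
  have hnegB : -B = B := by simp [hB]
  have hnegm : MeasurableSet (-(K ∩ B)) := hKm.neg
  set I := tangentMapE γ '' tangentDomain with hI
  have hIoff : ∀ x ∈ I, ∃ t, inner ℝ x (conormal γ t) = (0 : ℝ) := by
    rintro _ ⟨z, _, rfl⟩
    exact ⟨z 0, inner_tangentMap_conormal γ _ _ _⟩
  have hIB : I ⊆ B := by
    rintro _ ⟨z, hz, rfl⟩
    have h1 := norm_sq_tangentMap hγ (z 0) (z 1) (z 2)
    have h2 := hz.2.2
    rw [hB, mem_ball_zero_iff]
    change ‖tangentMap γ (z 0) (z 1) (z 2)‖ < 1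
    nlinarith [norm_nonneg (tangentMap γ (z 0) (z 1) (z 2))]
  have hdisj1 : Disjoint (K ∩ B) (-(K ∩ B)) := by
    rw [Set.disjoint_left]
    rintro x hx hx'
    exact neg_notMem_cone hγ hΩ hconv hx.1 (Set.mem_neg.1 hx').1
  have hdisj2 : Disjoint (K ∩ B ∪ -(K ∩ B)) I := by
    rw [Set.disjoint_left]
    rintro x hx hxI
    obtain ⟨t, ht⟩ := hIoff x hxI
    rcases hx with hx | hx
    · exact (inner_conormal_pos hγ hΩ hconv hx.1 t).ne' ht
    · have := inner_conormal_pos hγ hΩ hconv (Set.mem_neg.1 hx).1 t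
      rw [inner_neg_left, ht, neg_zero] at this
      exact lt_irrefl _ this
  have hsub : K ∩ B ∪ -(K ∩ B) ∪ I ⊆ B := by
    refine Set.union_subset (Set.union_subset Set.inter_subset_right ?_) hIB
    intro x hx
    rw [← hnegB]
    exact (Set.mem_neg.1 hx).2
  have hsup : B ⊆ (K ∩ B ∪ -(K ∩ B) ∪ I) ∪ (frontier K ∪ -frontier K) := by
    intro x hx
    have hxn : -x ∈ B := by rw [← Set.mem_neg, hnegB]; exact hx
    by_cases h1 : x ∈ closure K
    · by_cases h2 : x ∈ K
      · exact Or.inl (Or.inl (Or.inl ⟨h2, hx⟩))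
      · exact Or.inr (Or.inl (by rw [hKo.frontier_eq]; exact ⟨h1, h2⟩))
    by_cases h3 : -x ∈ closure K
    · by_cases h4 : -x ∈ K
      · exact Or.inl (Or.inl (Or.inr ⟨h4, hxn⟩))
      · exact Or.inr (Or.inr (by rw [Set.mem_neg, hKo.frontier_eq]; exact ⟨h3, h4⟩))
    obtain ⟨t, ht, a, b, hb, hab⟩ := exists_tangentMap_eq hγ hΩ hconv h1 h3
    refine Or.inl (Or.inr ⟨!₂[t, a, b], ⟨by simpa using ht, by simpa using hb, ?_⟩, ?_⟩)
    · have h5 := norm_sq_tangentMap hγ t a b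
      rw [hab] at h5
      rw [hB, mem_ball_zero_iff] at hx
      have : a ^ 2 + b ^ 2 < 1 := by nlinarith [norm_nonneg x]
      simpa using this
    · simpa [tangentMapE] using hab
  -- The leftover set is null because convex sets have null frontier.
  have hfr : volume (frontier K) = 0 := (convex_cone hγ hΩ hconv).addHaar_frontier volume
  have hnull : volume (frontier K ∪ -frontier K) = 0 :=
    measure_union_null hfr (by rw [Measure.measure_neg, hfr])
  have hvol : volume B = volume (K ∩ B) + volume (K ∩ B)
      + ENNReal.ofReal (2 / 3 * arcIntegral γ (geodesicCurvature γ)) := by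
    rw [← volume_image_tangentMapE hγ hΩ hconv, ← hI]
    nth_rewrite 3 [← Measure.measure_neg]
    rw [← measure_union' hdisj1 hKm, ← measure_union' hdisj2 (hKm.union hnegm)]
    refine le_antisymm ((measure_mono hsup).trans ?_) (measure_mono hsub)
    exact (measure_union_le _ _).trans (by rw [hnull, add_zero])
  have hfin : volume (K ∩ B) ≠ ⊤ :=
    ((measure_mono Set.inter_subset_right).trans_lt measure_ball_lt_top).ne
  have hreal := congrArg ENNReal.toReal hvol
  rw [ENNReal.toReal_add (ENNReal.add_ne_top.2 ⟨hfin, hfin⟩) ENNReal.ofReal_ne_top,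
    ENNReal.toReal_add hfin hfin, ENNReal.toReal_ofReal (mul_nonneg (by norm_num)
      (arcIntegral_geodesicCurvature_nonneg hγ hconv)), hB,
    EuclideanSpace.volume_ball_fin_three] at hreal
  have hball : (ENNReal.ofReal 1 ^ 3 * ENNReal.ofReal (Real.pi * 4 / 3)).toReal
      = Real.pi * 4 / 3 := by
    rw [ENNReal.ofReal_one, one_pow, one_mul, ENNReal.toReal_ofReal (by positivity)]
  rw [hball] at hreal
  rw [area_eq hΩ.isOpen, measureReal_def, ← hB, ← hK]
  linarith

theorem area_pos (hΩ : IsPositiveBoundary γ Ω) : 0 < area Ω := by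
  rw [area, measureReal_def]
  exact ENNReal.toReal_pos (hΩ.isOpen.measure_ne_zero _ hΩ.isConnected.nonempty)
    (measure_ne_top _ _)

/-! ### The remainder -/

theorem remainderDenom_pos {a b : ℝ} (ha : 0 < a) (hb : 0 < b) : 0 < remainderDenom a b := by
  unfold remainderDenom; positivity

/-- Rationalisation: `(1 + a²)(1 + b²) - (1 + ab)² = (a - b)²`. -/
theorem sq_sub_div_remainderDenom {a b : ℝ} (ha : 0 < a) (hb : 0 < b) :
    (a - b) ^ 2 / remainderDenom a b = √(1 + a ^ 2) * √(1 + b ^ 2) - 1 - a * b := by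
  rw [div_eq_iff (remainderDenom_pos ha hb).ne', remainderDenom, Real.sqrt_mul (by positivity)]
  have h1 := Real.sq_sqrt (show 0 ≤ 1 + a ^ 2 by positivity)
  have h2 := Real.sq_sqrt (show 0 ≤ 1 + b ^ 2 by positivity)
  linear_combination (-√(1 + b ^ 2) ^ 2) * h1 - (1 + a ^ 2) * h2

theorem continuous_sqrt_one_add_sq (hγ : IsSmoothSimpleClosed γ) :
    Continuous fun t => √(1 + geodesicCurvature γ t ^ 2) := by
  have := continuous_geodesicCurvature hγ
  fun_prop

theorem arcIntegral_combination (hγ : IsSmoothSimpleClosed γ) (a b c : ℝ) :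
    arcIntegral γ (fun t => a * √(1 + geodesicCurvature γ t ^ 2) + b
      + c * geodesicCurvature γ t) =
    a * totalCurvature γ + b * length γ + c * arcIntegral γ (geodesicCurvature γ) := by
  have hk := continuous_geodesicCurvature hγ
  have hv := continuous_speed hγ
  have hs := continuous_sqrt_one_add_sq hγ
  unfold totalCurvature length arcIntegral
  rw [← intervalIntegral.integral_const_mul, ← intervalIntegral.integral_const_mul,
    ← intervalIntegral.integral_const_mul, ← intervalIntegral.integral_add,
    ← intervalIntegral.integral_add]
  · congr 1
    funext t
    ring
  all_goals exact Continuous.intervalIntegrable (by fun_prop) _ _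

theorem remainder_eq (hγ : IsSmoothSimpleClosed γ) (hconv : IsStrictlyConvex γ) :
    remainder γ = totalCurvature γ ^ 2 - length γ ^ 2
      - arcIntegral γ (geodesicCurvature γ) ^ 2 := by
  have hinner : ∀ s, arcIntegral γ (fun σ => (geodesicCurvature γ s - geodesicCurvature γ σ) ^ 2 /
      remainderDenom (geodesicCurvature γ s) (geodesicCurvature γ σ)) =
      totalCurvature γ * √(1 + geodesicCurvature γ s ^ 2) + -length γ
        + -arcIntegral γ (geodesicCurvature γ) * geodesicCurvature γ s := by
    intro s
    have h := arcIntegral_combination hγ (√(1 + geodesicCurvature γ s ^ 2)) (-1)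
      (-geodesicCurvature γ s)
    rw [show totalCurvature γ * √(1 + geodesicCurvature γ s ^ 2) + -length γ
        + -arcIntegral γ (geodesicCurvature γ) * geodesicCurvature γ s
        = √(1 + geodesicCurvature γ s ^ 2) * totalCurvature γ + -1 * length γ
          + -geodesicCurvature γ s * arcIntegral γ (geodesicCurvature γ) by ring, ← h]
    congr 1
    funext σ
    rw [sq_sub_div_remainderDenom (hconv s) (hconv σ)]
    ring
  unfold remainder
  simp only [hinner]
  rw [arcIntegral_combination hγ]
  ring

theorem remainder_nonneg (hγ : IsSmoothSimpleClosed γ) (hconv : IsStrictlyConvex γ) :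
    0 ≤ remainder γ := by
  have hpi := Real.two_pi_pos.le
  refine intervalIntegral.integral_nonneg hpi fun s _ => mul_nonneg ?_ (speed_pos hγ s).le
  exact intervalIntegral.integral_nonneg hpi fun σ _ => mul_nonneg
    (div_nonneg (sq_nonneg _) (remainderDenom_pos (hconv s) (hconv σ)).le) (speed_pos hγ σ).le

theorem arcIntegral_pos (hγ : IsSmoothSimpleClosed γ) {f : ℝ → ℝ} (hf : Continuous f)
    (hpos : ∀ t, 0 ≤ f t) {t₀ : ℝ} (ht₀ : t₀ ∈ Set.Icc 0 (2 * Real.pi)) (h : 0 < f t₀) :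
    0 < arcIntegral γ f :=
  intervalIntegral.integral_pos Real.two_pi_pos (hf.mul (continuous_speed hγ)).continuousOn
    (fun t _ => mul_nonneg (hpos t) (speed_pos hγ t).le)
    ⟨t₀, ht₀, mul_pos h (speed_pos hγ t₀)⟩

theorem length_pos (hγ : IsSmoothSimpleClosed γ) : 0 < length γ :=
  arcIntegral_pos hγ continuous_const (fun _ => zero_le_one) ⟨le_rfl, Real.two_pi_pos.le⟩ one_pos

theorem arcIntegral_geodesicCurvature_pos (hγ : IsSmoothSimpleClosed γ)
    (hconv : IsStrictlyConvex γ) : 0 < arcIntegral γ (geodesicCurvature γ) :=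
  arcIntegral_pos hγ (continuous_geodesicCurvature hγ) (fun t => (hconv t).le)
    ⟨le_rfl, Real.two_pi_pos.le⟩ (hconv 0)

theorem totalCurvature_pos (hγ : IsSmoothSimpleClosed γ) : 0 < totalCurvature γ :=
  arcIntegral_pos hγ (continuous_sqrt_one_add_sq hγ) (fun _ => Real.sqrt_nonneg _)
    ⟨le_rfl, Real.two_pi_pos.le⟩ (t₀ := 0) (by positivity)

/-- The remainder vanishes exactly when the geodesic curvature is constant. -/
theorem remainder_eq_zero_iff (hγ : IsSmoothSimpleClosed γ) (hconv : IsStrictlyConvex γ) :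
    remainder γ = 0 ↔ ∃ κ, ∀ t, geodesicCurvature γ t = κ := by
  constructor
  · intro hR
    rw [remainder_eq hγ hconv] at hR
    set W := totalCurvature γ with hW
    set l := length γ with hl
    set κ := arcIntegral γ (geodesicCurvature γ) with hκ
    have hWpos : 0 < W := totalCurvature_pos hγ
    have hlpos : 0 < l := length_pos hγ
    have hκpos : 0 < κ := arcIntegral_geodesicCurvature_pos hγ hconv
    -- Lagrange's identity with `W² = l² + κ²`. It gives `W√(1 + k_g²) ≥ l + κ k_g`; the difference
    -- integrates to `W² - l² - κ² = 0`, so it vanishes identically and `l k_g = κ`.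
    have hsq : ∀ t, (W * √(1 + geodesicCurvature γ t ^ 2)) ^ 2
        = (l + κ * geodesicCurvature γ t) ^ 2 + (l * geodesicCurvature γ t - κ) ^ 2 := by
      intro t
      have h1 := Real.sq_sqrt (show 0 ≤ 1 + geodesicCurvature γ t ^ 2 by positivity)
      linear_combination W ^ 2 * h1 + (1 + geodesicCurvature γ t ^ 2) * hR
    have hnonneg : ∀ t, 0 ≤ W * √(1 + geodesicCurvature γ t ^ 2) + -l
        + -κ * geodesicCurvature γ t := by
      intro t
      have h2 : l + κ * geodesicCurvature γ t ≤ W * √(1 + geodesicCurvature γ t ^ 2) :=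
        le_of_sq_le_sq (by rw [hsq]; nlinarith [sq_nonneg (l * geodesicCurvature γ t - κ)])
          (by positivity)
      linarith
    have hint := arcIntegral_combination hγ W (-l) (-κ)
    rw [← hW, ← hl, ← hκ, show W * W + -l * l + -κ * κ = 0 by linarith] at hint
    have hcont : Continuous fun t => W * √(1 + geodesicCurvature γ t ^ 2) + -l
        + -κ * geodesicCurvature γ t := by
      have := continuous_geodesicCurvature hγ
      fun_prop
    refine ⟨κ / l, fun t => ?_⟩
    obtain ⟨s, hs, hst⟩ := (geodesicCurvature_periodic γ).exists_mem_Ico₀ Real.two_pi_pos t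
    rw [hst]
    have hzero : W * √(1 + geodesicCurvature γ s ^ 2) + -l + -κ * geodesicCurvature γ s = 0 := by
      refine le_antisymm (not_lt.1 fun h => ?_) (hnonneg s)
      exact (arcIntegral_pos hγ hcont hnonneg (Set.Ico_subset_Icc_self hs) h).ne' hint
    have h3 := hsq s
    rw [show W * √(1 + geodesicCurvature γ s ^ 2) = l + κ * geodesicCurvature γ s by
      linarith] at h3
    have h4 : (l * geodesicCurvature γ s - κ) ^ 2 = 0 := by linarith
    rw [eq_div_iff hlpos.ne']
    have := pow_eq_zero_iff (two_ne_zero) |>.1 h4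
    linarith
  · rintro ⟨κ, hκ⟩
    simp [remainder, arcIntegral, hκ]

/-! ### Curves of constant geodesic curvature -/

theorem exists_cos_sin_eq {c s : ℝ} (h : c ^ 2 + s ^ 2 = 1) :
    ∃ θ ∈ Set.Ico 0 (2 * Real.pi), Real.cos θ = c ∧ Real.sin θ = s := by
  have hz : ‖(⟨c, s⟩ : ℂ)‖ = 1 := by
    rw [Complex.norm_def, Complex.normSq_mk, show c * c + s * s = 1 by linarith, Real.sqrt_one]
  have hz0 : (⟨c, s⟩ : ℂ) ≠ 0 := by
    intro h0
    rw [h0, norm_zero] at hz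
    exact zero_ne_one hz
  obtain ⟨θ, hθ, heq⟩ := (show Function.Periodic (fun θ => (Real.cos θ, Real.sin θ))
    (2 * Real.pi) from fun θ => by simp).exists_mem_Ico₀ Real.two_pi_pos (Complex.arg ⟨c, s⟩)
  simp only [Prod.mk.injEq] at heq
  refine ⟨θ, hθ, ?_, ?_⟩
  · rw [← heq.1, Complex.cos_arg hz0, hz, div_one]
  · rw [← heq.2, Complex.sin_arg, hz, div_one]

theorem constant_of_hasDerivAt_zero {f : ℝ → E3} (hf : ∀ t, HasDerivAt f 0 t) (t s : ℝ) :
    f t = f s :=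
  is_const_of_deriv_eq_zero (fun t => (hf t).differentiableAt) (fun t => (hf t).deriv) t s

/-- For constant curvature the vector `κγ + η` is constant, while `M = γ - κη` and `Nγ_s` rotate
into each other through the angle `φ`, which is `N` times arclength. The point is recovered from `(1
+ κ²)γ = κ(κγ + η) + M`. -/
theorem lift_eq_of_geodesicCurvature_const (hγ : IsSmoothSimpleClosed γ) {κ : ℝ}
    (hκ : ∀ t, geodesicCurvature γ t = κ) {θ : ℝ} (hθ : θ ∈ Set.Ico 0 (2 * Real.pi)) :
    ∃ t, (1 + κ ^ 2) • lift γ t = κ • (κ • lift γ 0 + conormal γ 0)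
      + Real.cos θ • (lift γ 0 - κ • conormal γ 0)
      + (√(1 + κ ^ 2) * Real.sin θ) • tangent γ 0 := by
  set N := √(1 + κ ^ 2) with hN
  have hNpos : 0 < N := by positivity
  have hN2 : N ^ 2 = 1 + κ ^ 2 := Real.sq_sqrt (by positivity)
  set φ : ℝ → ℝ := fun t => N * ∫ u in (0 : ℝ)..t, speed γ u with hφ
  have hφd : ∀ t, HasDerivAt φ (N * speed γ t) t := fun t =>
    ((continuous_speed hγ).integral_hasStrictDerivAt 0 t).hasDerivAt.const_mul N
  have hφ0 : φ 0 = 0 := by simp [hφ]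
  set M : ℝ → E3 := fun t => lift γ t - κ • conormal γ t with hM
  have hMd : ∀ t, HasDerivAt M ((N ^ 2 * speed γ t) • tangent γ t) t := by
    intro t
    refine ((hasDerivAt_lift hγ t).sub ((hasDerivAt_conormal hγ t).const_smul κ)).congr_deriv ?_
    rw [hκ, hN2]; module
  have hTd : ∀ t, HasDerivAt (tangent γ) (-(speed γ t) • M t) t := by
    intro t
    refine (hasDerivAt_tangent hγ t).congr_deriv ?_
    rw [hκ]; simp only [hM]; module
  have hPd : ∀ t, HasDerivAt (fun t => κ • lift γ t + conormal γ t) 0 t := by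
    intro t
    refine (((hasDerivAt_lift hγ t).const_smul κ).add (hasDerivAt_conormal hγ t)).congr_deriv ?_
    rw [hκ]; module
  have hP : ∀ t, κ • lift γ t + conormal γ t = κ • lift γ 0 + conormal γ 0 := fun t =>
    constant_of_hasDerivAt_zero hPd t 0
  have hA : ∀ t, Real.cos (φ t) • M t - (N * Real.sin (φ t)) • tangent γ t = M 0 := by
    intro t
    have hd : ∀ t, HasDerivAt
        (fun t => Real.cos (φ t) • M t - (N * Real.sin (φ t)) • tangent γ t) 0 t := by
      intro t
      refine (((hφd t).cos.smul (hMd t)).sub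
        (((hφd t).sin.const_mul N).smul (hTd t))).congr_deriv ?_
      module
    have h := constant_of_hasDerivAt_zero hd t 0
    simpa [hφ0] using h
  have hB : ∀ t, Real.sin (φ t) • M t + (N * Real.cos (φ t)) • tangent γ t = N • tangent γ 0 := by
    intro t
    have hd : ∀ t, HasDerivAt
        (fun t => Real.sin (φ t) • M t + (N * Real.cos (φ t)) • tangent γ t) 0 t := by
      intro t
      refine (((hφd t).sin.smul (hMd t)).add
        (((hφd t).cos.const_mul N).smul (hTd t))).congr_deriv ?_
      module
    have h := constant_of_hasDerivAt_zero hd t 0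
    simpa [hφ0] using h
  have hMt : ∀ t, M t = Real.cos (φ t) • M 0 + (N * Real.sin (φ t)) • tangent γ 0 := by
    intro t
    have h1 : (N * Real.sin (φ t)) • tangent γ 0 = Real.sin (φ t) • N • tangent γ 0 := by module
    have h2 : M t = (Real.sin (φ t) ^ 2 + Real.cos (φ t) ^ 2) • M t := by
      rw [Real.sin_sq_add_cos_sq, one_smul]
    rw [h1, ← hA t, ← hB t]
    refine h2.trans ?_
    module
  -- Closedness: `M` returns to its initial value, so the positive angle `φ(2π)` has cosine `1`.
  -- Hence every `θ` is attained.
  have hφ2 : 2 * Real.pi ≤ φ (2 * Real.pi) := by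
    have hpos : 0 < φ (2 * Real.pi) := by
      have := length_pos hγ
      simp only [length, arcIntegral, one_mul] at this
      exact mul_pos hNpos this
    by_contra! hlt
    have h1 := hMt (2 * Real.pi)
    have h2 : M (2 * Real.pi) = M 0 := by
      have hl := lift_periodic γ 0
      have hc := conormal_periodic γ 0
      rw [zero_add] at hl hc
      simp only [hM, hl, hc]
    have h3 := congrArg (fun x => (inner ℝ x (lift γ 0) : ℝ)) h1
    have hM0 : inner ℝ (M 0) (lift γ 0) = (1 : ℝ) := by
      simp only [hM]
      rw [inner_sub_left, inner_smul_left, real_inner_comm (lift γ 0) (conormal γ 0),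
        inner_lift_conormal, inner_lift_lift]
      simp
    simp only [h2, inner_add_left, inner_smul_left, hM0, conj_trivial,
      real_inner_comm (lift γ 0) (tangent γ 0), inner_lift_tangent hγ] at h3
    have h4 : Real.cos (φ (2 * Real.pi)) = 1 := by linarith
    rw [Real.cos_eq_one_iff_of_lt_of_lt (by linarith [Real.pi_pos]) hlt] at h4
    exact hpos.ne' h4
  have hφc : Continuous φ := continuous_iff_continuousAt.2 fun t => (hφd t).continuousAt
  obtain ⟨t, -, ht⟩ := intermediate_value_Icc Real.two_pi_pos.le hφc.continuousOn
    ⟨hφ0.le.trans hθ.1, hθ.2.le.trans hφ2⟩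
  refine ⟨t, ?_⟩
  have h5 := hMt t
  rw [ht] at h5
  have h6 : (1 + κ ^ 2) • lift γ t = κ • (κ • lift γ t + conormal γ t) + M t := by
    simp only [hM]; module
  rw [h6, hP, h5]
  simp only [hM]
  module

theorem isGeodesicCircle_of_geodesicCurvature_const (hγ : IsSmoothSimpleClosed γ) {κ : ℝ}
    (hκ : ∀ t, geodesicCurvature γ t = κ) : IsGeodesicCircle γ := by
  set N := √(1 + κ ^ 2) with hN
  have hNpos : 0 < N := by positivity
  have hN2 : N ^ 2 = 1 + κ ^ 2 := Real.sq_sqrt (by positivity)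
  set P : E3 := κ • lift γ 0 + conormal γ 0 with hPdef
  have hPd : ∀ t, HasDerivAt (fun t => κ • lift γ t + conormal γ t) 0 t := by
    intro t
    refine (((hasDerivAt_lift hγ t).const_smul κ).add (hasDerivAt_conormal hγ t)).congr_deriv ?_
    rw [hκ]; module
  have hP : ∀ t, κ • lift γ t + conormal γ t = P := fun t => constant_of_hasDerivAt_zero hPd t 0
  have hPn : ‖P‖ = N := by
    have h1 : ‖P‖ ^ 2 = N ^ 2 := by
      rw [← real_inner_self_eq_norm_sq, hN2, hPdef]
      simp only [inner_add_left, inner_add_right, inner_smul_left, inner_smul_right,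
        conj_trivial, inner_lift_lift, inner_lift_conormal, inner_conormal_conormal hγ,
        real_inner_comm (lift γ 0) (conormal γ 0)]
      ring
    exact (sq_eq_sq₀ (norm_nonneg _) hNpos.le).1 h1
  have hκN : |κ| < N := Real.lt_sqrt (abs_nonneg κ) |>.2 (by rw [sq_abs]; linarith)
  rw [abs_lt] at hκN
  have hlow : -1 < κ / N := by rw [lt_div_iff₀ hNpos]; linarith
  have hupp : κ / N < 1 := by rw [div_lt_one hNpos]; linarith
  let p : S2 := ⟨N⁻¹ • P, by
    rw [mem_sphere_zero_iff_norm, norm_smul, hPn, norm_inv, Real.norm_of_nonneg hNpos.le,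
      inv_mul_cancel₀ hNpos.ne']⟩
  have hang : ∀ x : S2, InnerProductGeometry.angle (x : E3) (p : E3) = Real.arccos (κ / N) ↔
      inner ℝ (x : E3) P = κ := by
    intro x
    have hval : InnerProductGeometry.angle (x : E3) (p : E3)
        = Real.arccos (inner ℝ (x : E3) P / N) := by
      rw [InnerProductGeometry.angle, norm_coe, norm_coe]
      congr 1
      change inner ℝ (x : E3) (N⁻¹ • P) / _ = _
      rw [inner_smul_right]
      field_simp
    have hb : |inner ℝ (x : E3) P| ≤ N := by
      have := abs_real_inner_le_norm (x : E3) P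
      rwa [norm_coe, one_mul, hPn] at this
    rw [abs_le] at hb
    rw [hval]
    constructor
    · intro h
      have h1 := Real.arccos_injOn
        ⟨by rw [le_div_iff₀ hNpos]; linarith, by rw [div_le_one hNpos]; exact hb.2⟩
        ⟨hlow.le, hupp.le⟩ h
      field_simp at h1
      exact h1
    · intro h
      rw [h]
  refine ⟨p, Real.arccos (κ / N), ⟨Real.arccos_pos.2 hupp, ?_⟩, ?_⟩
  · refine (Real.arccos_le_pi _).lt_of_ne fun h => ?_
    rw [Real.arccos_eq_pi] at h
    linarith
  ext x
  change _ ↔ InnerProductGeometry.angle (x : E3) (p : E3) = Real.arccos (κ / N)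
  rw [hang]
  constructor
  · rintro ⟨z, rfl⟩
    obtain ⟨t, ht, -⟩ := exists_lift_eq γ z
    rw [← ht, ← hP t, inner_add_right, inner_smul_right, inner_lift_lift, inner_lift_conormal]
    ring
  · intro hx
    set α : ℝ := inner ℝ (x : E3) (lift γ 0) with hα
    set β : ℝ := inner ℝ (x : E3) (tangent γ 0) with hβ
    set c : ℝ := inner ℝ (x : E3) (conormal γ 0) with hc
    have hexp := frame_expansion hγ 0 (x : E3)
    rw [← hα, ← hβ, ← hc] at hexp
    have hlin : c = κ - κ * α := by
      rw [hPdef, inner_add_right, inner_smul_right, ← hα, ← hc] at hx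
      linarith
    have hsq : α ^ 2 + β ^ 2 + c ^ 2 = 1 := by
      have h1 : inner ℝ (x : E3) (x : E3) = (1 : ℝ) := by
        rw [real_inner_self_eq_norm_sq, norm_coe]; norm_num
      nth_rewrite 2 [hexp] at h1
      simp only [inner_add_right, inner_smul_right, ← hα, ← hβ, ← hc] at h1
      linarith
    -- The values are forced by comparing the `γ(0)` and `γ_s(0)` coefficients of `(1 + κ²) • x`
    -- with the parametrisation.
    obtain ⟨θ, hθ, hcos, hsin⟩ := exists_cos_sin_eq
      (c := N ^ 2 * α - κ ^ 2) (s := N * β) (by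
        rw [mul_pow, hN2]
        rw [hlin] at hsq
        linear_combination (1 + κ ^ 2) * hsq)
    obtain ⟨t, ht⟩ := lift_eq_of_geodesicCurvature_const hγ hκ hθ
    refine ⟨Circle.exp t, Subtype.ext ?_⟩
    change lift γ t = x
    have hne : (1 + κ ^ 2) ≠ 0 := by positivity
    refine smul_right_injective E3 hne ?_
    simp only
    rw [ht, hcos, hsin, ← hN, ← mul_assoc, ← sq, hN2, hexp, hlin]
    module

/-- Differentiating `⟨γ, p⟩ = cos r` twice gives `⟨γ_s, p⟩ = 0` and `k_g⟨η, p⟩ = cos r`, and `|p| =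
1` gives `⟨η, p⟩² = sin² r`. The sign of `⟨η, p⟩` depends on which of the two centres `p` is;
positivity of `k_g` selects the absolute value. -/
theorem exists_geodesicCurvature_const_of_isGeodesicCircle (hγ : IsSmoothSimpleClosed γ)
    (hconv : IsStrictlyConvex γ) (h : IsGeodesicCircle γ) :
    ∃ κ, ∀ t, geodesicCurvature γ t = κ := by
  obtain ⟨p, r, hr, hrange⟩ := h
  have hsin : 0 < Real.sin r := Real.sin_pos_of_mem_Ioo hr
  have hL : ∀ t, inner ℝ (lift γ t) (p : E3) = Real.cos r := by
    intro t
    have h1 : γ (Circle.exp t) ∈ Set.range γ := Set.mem_range_self _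
    rw [hrange] at h1
    have h2 : InnerProductGeometry.angle (lift γ t) (p : E3) = r := h1
    have h3 := InnerProductGeometry.cos_angle (lift γ t) (p : E3)
    rw [h2, norm_lift, norm_coe] at h3
    rw [h3]; simp
  have hT : ∀ t, inner ℝ (tangent γ t) (p : E3) = (0 : ℝ) := by
    intro t
    have h1 := (hasDerivAt_lift hγ t).inner ℝ (hasDerivAt_const t (p : E3))
    rw [funext hL] at h1
    have h2 := h1.unique (hasDerivAt_const t (Real.cos r))
    rw [inner_zero_right, zero_add, inner_smul_left, conj_trivial] at h2
    exact (mul_eq_zero.1 h2).resolve_left (speed_pos hγ t).ne'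
  have hE : ∀ t, geodesicCurvature γ t * inner ℝ (conormal γ t) (p : E3) = Real.cos r := by
    intro t
    have h1 := (hasDerivAt_tangent hγ t).inner ℝ (hasDerivAt_const t (p : E3))
    rw [funext hT] at h1
    have h2 := h1.unique (hasDerivAt_const t (0 : ℝ))
    rw [inner_zero_right, zero_add, inner_smul_left, conj_trivial] at h2
    have h3 := (mul_eq_zero.1 h2).resolve_left (speed_pos hγ t).ne'
    rw [inner_add_left, inner_neg_left, inner_smul_left, conj_trivial, hL] at h3
    linarith
  refine ⟨|Real.cos r| / Real.sin r, fun t => ?_⟩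
  have hn : Real.cos r ^ 2 + inner ℝ (conormal γ t) (p : E3) ^ 2 = 1 := by
    have h1 : inner ℝ (p : E3) (p : E3) = (1 : ℝ) := by
      rw [real_inner_self_eq_norm_sq, norm_coe]; norm_num
    nth_rewrite 1 [frame_expansion hγ t (p : E3)] at h1
    simp only [inner_add_left, inner_smul_left, conj_trivial, hL, hT,
      real_inner_comm (lift γ t) (p : E3), real_inner_comm (tangent γ t) (p : E3),
      real_inner_comm (conormal γ t) (p : E3)] at h1
    linarith
  have hsq : (geodesicCurvature γ t * Real.sin r) ^ 2 = |Real.cos r| ^ 2 := by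
    have h1 := Real.sin_sq_add_cos_sq r
    have h2 : Real.sin r ^ 2 = inner ℝ (conormal γ t) (p : E3) ^ 2 := by linarith
    rw [sq_abs, mul_pow, h2, ← mul_pow, hE]
  rw [eq_div_iff hsin.ne']
  exact (sq_eq_sq₀ (mul_nonneg (hconv t).le hsin.le) (abs_nonneg _)).1 hsq

end

end SphereCurve

/-! ### The reverse isoperimetric inequality -/

open SphereCurve in
theorem mainTheorem1 (γ : Circle → S2) (Ω : Set S2)
    (hγ : IsSmoothSimpleClosed γ) (hΩ : IsPositiveBoundary γ Ω) (hconv : IsStrictlyConvex γ) :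
    (0 < area Ω ∧ area Ω < 2 * Real.pi) ∧
    length γ ^ 2 - area Ω * (4 * Real.pi - area Ω) ≤ totalCurvature γ ^ 2 - 4 * Real.pi ^ 2 ∧
    length γ ^ 2 - area Ω * (4 * Real.pi - area Ω)
      = totalCurvature γ ^ 2 - 4 * Real.pi ^ 2 - remainder γ ∧
    (∀ s σ : ℝ, 0 < remainderDenom (geodesicCurvature γ s) (geodesicCurvature γ σ)) ∧
    0 ≤ remainder γ ∧
    (length γ ^ 2 - area Ω * (4 * Real.pi - area Ω) = totalCurvature γ ^ 2 - 4 * Real.pi ^ 2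
      ↔ IsGeodesicCircle γ) := by
  have hGB := area_eq_two_pi_sub hγ hΩ hconv
  have hk := arcIntegral_geodesicCurvature_pos hγ hconv
  have hR := remainder_nonneg hγ hconv
  have hid : length γ ^ 2 - area Ω * (4 * Real.pi - area Ω)
      = totalCurvature γ ^ 2 - 4 * Real.pi ^ 2 - remainder γ := by
    -- With `A = 2π - K`, the product `A(4π - A)` is `(2π - K)(2π + K)`.
    rw [remainder_eq hγ hconv, hGB]; ring
  refine ⟨⟨area_pos hΩ, by linarith⟩, by linarith, hid,
    fun s σ => remainderDenom_pos (hconv s) (hconv σ), hR, ?_⟩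
  rw [hid, sub_eq_self, remainder_eq_zero_iff hγ hconv]
  exact ⟨fun ⟨_, hκ⟩ => isGeodesicCircle_of_geodesicCurvature_const hγ hκ,
    exists_geodesicCurvature_const_of_isGeodesicCircle hγ hconv⟩
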